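/- Let $\mathcal B$ be a real Banach space, let $(T_t)_{t\ge 0}$ be a $C_0$-semigroup of bounded linear operators on $\mathcal B$, and suppose that for some $r\in\mathbb R$ the operator $T_t$ is compact for every $t>r$. Put $\log 0=-\infty$. Then there is a decreasing sequence $(\lambda_i)_{i\ge 1}$ in $[-\infty,\infty)$ with $\lim_{n\to\infty}\lambda_n=-\infty$ and, for every $i$, either $\lambda_i>\lambda_{i+1}$ or $\lambda_i=\lambda_{i+1}=-\infty$, such that with $$F_{\lambda}:=\Big\{x\in\mathcal B:\ \limsup_{t\to\infty}\tfrac1t\log\|T_tx\|\le\lambda\Big\}$$ each $F_{\lambda_i}$ is a linear subspace and the following hold. * $\cdots\subseteq F_{\lambda_2}\subseteq F_{\lambda_1}=\mathcal B$, and for every $i$ with $\lambda_i>\lambda_{i+1}$ and every $x\in\mathcal B$: $x\in F_{\lambda_i}\setminus F_{\lambda_{i+1}}$ if and only if $\lim_{t\to\infty}\frac1t\log\|T_tx\|$ exists and equals $\lambda_i$. * There are integers $m_1,m_2,\ldots\ge 0$ such that $\operatorname{codim}F_{\lambda_j}=m_1+\dots+m_{j-1}<\infty$ for every $j\ge1$,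 and $m_i\ge 1$ whenever $\lambda_i>\lambda_{i+1}$. * For every $i$ with $\lambda_i>\lambda_{i+1}$ there is a unique $m_i$-dimensional subspace $H^i\subseteq\mathcal B$ such that 1. (Invariance) $T_t(H^i)=H^i$ for every $t\ge0$; 2. (Splitting) $H^i\oplus F_{\lambda_{i+1}}=F_{\lambda_i}$; 3. (Fast growth) each $T_t$ is injective on $H^i$, and for every $h\in H^i\setminus\{0\}$ $$\lim_{t\to\infty}\tfrac1t\log\|T_th\|=\lambda_i,\qquad \lim_{t\to\infty}\tfrac1t\log\|(T_t|_{H^i})^{-1}h\|=-\lambda_i .$$ In particular, $\mathcal B=H^1\oplus\cdots\oplus H^i\oplus F_{\lambda_{i+1}}$ for every $i$ with $\lambda_i>\lambda_{i+1}$. Here the direct sums are algebraic direct sums of linear subspaces. -/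

import Mathlib

open Filter Topology
open scoped NNReal ENNReal

/-- A strongly continuous semigroup (`C₀`-semigroup) of bounded linear operators on a real
normed space. -/
structure C0Semigroup (B : Type*) [NormedAddCommGroup B] [NormedSpace ℝ B] where
  /-- the bounded operator at time `t ≥ 0` -/
  op : ℝ≥0 → B →L[ℝ] B
  op_zero : op 0 = ContinuousLinearMap.id ℝ B
  op_add : ∀ t s : ℝ≥0, op (t + s) = (op t).comp (op s)
  continuous_op : ∀ x : B, Continuous fun t : ℝ≥0 => op t x

/-- `(1 / t) * log ‖y‖` with values in the extended reals; `log 0 = -∞`. -/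
noncomputable def logRate {B : Type*} [NormedAddCommGroup B] (t : ℝ≥0) (y : B) : EReal :=
  ENNReal.log ‖y‖ₑ / ((t : ℝ) : EReal)

/-- If `‖z‖ ≤ C * max ‖x‖ ‖y‖` along three paths, the upper growth rate of `z` is at most the
larger of those of `x` and `y`. -/
theorem limsup_logRate_le_max {B : Type*} [NormedAddCommGroup B] (x y z : ℝ≥0 → B) (C : ℝ≥0)
    (h : ∀ t, ‖z t‖ₑ ≤ (C : ℝ≥0∞) * max ‖x t‖ₑ ‖y t‖ₑ) :
    limsup (fun t => logRate t (z t)) atTop ≤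
      max (limsup (fun t => logRate t (x t)) atTop)
        (limsup (fun t => logRate t (y t)) atTop) := by
  have hC1 : (1 : ℝ) ≤ ((max 1 C : ℝ≥0) : ℝ) := by exact_mod_cast le_max_left 1 C
  set K : ℝ := Real.log ((max 1 C : ℝ≥0) : ℝ) with hK
  have hlogK : ENNReal.log ((max 1 C : ℝ≥0) : ℝ≥0∞) = (K : EReal) := by
    rw [ENNReal.log_of_nnreal]
    exact (lt_of_lt_of_le one_pos (le_max_left 1 C)).ne'
  have hlim : Tendsto (fun t : ℝ≥0 => ((K / (t : ℝ) : ℝ) : EReal)) atTop (𝓝 0) := by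
    have h1 : Tendsto (fun t : ℝ≥0 => K / (t : ℝ)) atTop (𝓝 0) :=
      Tendsto.const_div_atTop (NNReal.tendsto_coe_atTop.2 tendsto_id) K
    exact_mod_cast (continuous_coe_real_ereal.tendsto (0 : ℝ)).comp h1
  have hle : ∀ t : ℝ≥0, logRate t (z t) ≤
      ((K / (t : ℝ) : ℝ) : EReal) + max (logRate t (x t)) (logRate t (y t)) := by
    intro t
    have ht : (0 : EReal) ≤ ((t : ℝ) : EReal) := by exact_mod_cast t.2
    have hmax : max (logRate t (x t)) (logRate t (y t)) =
        ENNReal.log (max ‖x t‖ₑ ‖y t‖ₑ) / ((t : ℝ) : EReal) := by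
      have hm : Monotone fun a : ℝ≥0∞ => ENNReal.log a / ((t : ℝ) : EReal) :=
        fun a b hab => EReal.monotone_div_right_of_nonneg ht (ENNReal.log_monotone hab)
      exact (hm.map_max).symm
    rw [hmax, EReal.coe_div, ← hlogK, logRate,
      ← EReal.add_div_of_nonneg_right ht, ← ENNReal.log_mul_add]
    refine EReal.monotone_div_right_of_nonneg ht (ENNReal.log_monotone ((h t).trans ?_))
    gcongr
    exact le_max_right _ _
  calc limsup (fun t => logRate t (z t)) atTop
      ≤ limsup (fun t : ℝ≥0 => ((K / (t : ℝ) : ℝ) : EReal) +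
          max (logRate t (x t)) (logRate t (y t))) atTop :=
        limsup_le_limsup (Eventually.of_forall hle)
    _ ≤ limsup (fun t : ℝ≥0 => ((K / (t : ℝ) : ℝ) : EReal)) atTop +
          limsup (fun t : ℝ≥0 => max (logRate t (x t)) (logRate t (y t))) atTop := by
        refine EReal.limsup_add_le (Or.inl ?_) (Or.inl ?_) <;> rw [hlim.limsup_eq] <;> simp
    _ = _ := by
        rw [hlim.limsup_eq, zero_add, limsup_max]

namespace C0Semigroup

variable {B : Type*} [NormedAddCommGroup B] [NormedSpace ℝ B]

/-- `F_μ = {x | limsup_{t → ∞} (1 / t) log ‖T_t x‖ ≤ μ}`, a linear subspace of `B`. -/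
noncomputable def slow (T : C0Semigroup B) (μ : EReal) : Submodule ℝ B where
  carrier := {x | limsup (fun t : ℝ≥0 => logRate t (T.op t x)) atTop ≤ μ}
  zero_mem' := by
    have h : (fun t : ℝ≥0 => logRate t (T.op t (0 : B))) =ᶠ[atTop] fun _ => (⊥ : EReal) := by
      filter_upwards [eventually_gt_atTop (0 : ℝ≥0)] with t ht
      have : (0 : EReal) < ((t : ℝ) : EReal) := by exact_mod_cast ht
      simp [logRate, EReal.bot_div_of_pos_ne_top this (EReal.coe_ne_top _)]
    change limsup _ _ ≤ μ
    rw [limsup_congr h]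
    simp
  add_mem' := by
    intro x y hx hy
    refine (limsup_logRate_le_max (fun t => T.op t x) (fun t => T.op t y)
      (fun t => T.op t (x + y)) 2 fun t => ?_).trans (max_le hx hy)
    rw [map_add]
    refine (enorm_add_le _ _).trans ?_
    rw [ENNReal.coe_ofNat, two_mul]
    exact add_le_add (le_max_left _ _) (le_max_right _ _)
  smul_mem' := by
    intro c x hx
    refine (limsup_logRate_le_max (fun t => T.op t x) (fun t => T.op t x)
      (fun t => T.op t (c • x)) ‖c‖₊ fun t => ?_).trans (max_le hx hx)
    rw [map_smul, enorm_smul, max_self]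
    rfl

/-- `H` is an `m`-dimensional fast-growing space for the consecutive exponents `a > b`:
it is invariant, it complements `F_b` in `F_a`, and on it the semigroup has exact exponential
rate `a` forwards and `-a` backwards in time. -/
structure IsFastSpace (T : C0Semigroup B) (a b : EReal) (m : ℕ) (H : Submodule ℝ B) : Prop where
  finiteDimensional : FiniteDimensional ℝ H
  finrank_eq : Module.finrank ℝ H = m
  invariant : ∀ t : ℝ≥0, H.map (T.op t : B →ₗ[ℝ] B) = H
  disjoint : Disjoint H (T.slow b)
  sup_eq : H ⊔ T.slow b = T.slow a
  forward : ∀ h ∈ H, h ≠ 0 → Tendsto (fun t : ℝ≥0 => logRate t (T.op t h)) atTop (𝓝 a)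
  /-- `T_t` is injective on `H`, so that with `invariant` it is a bijection of `H` and
  `Function.invFunOn (T_t) H` is its inverse `H → H`. -/
  injOn : ∀ t : ℝ≥0, Set.InjOn (T.op t) (H : Set B)
  backward : ∀ h ∈ H, h ≠ 0 →
    Tendsto (fun t : ℝ≥0 => logRate t (Function.invFunOn (T.op t) (H : Set B) h))
      atTop (𝓝 (-a))

end C0Semigroup

/-!
Let `K = T_{t₀}` be one compact operator of the semigroup. Everything rests on a *dominated
splitting*: for every real `a` there is a bounded finite-rank projection `P` commuting with all
`T_t` such that the semigroup grows on `ker P` at some exponential rate strictly below `a`, and on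
`range P` at least at rate `a` (`C0Semigroup.exists_isSplitting`).

For a compact operator on a complex Banach space `P` is the spectral projection for the eigenvalues
of modulus at least `ρ = exp (a t₀)`. Among the products of factors `K - l`, `ρ ≤ ‖l‖`, some `S` has
maximal kernel, by Riesz's compactness argument (`exists_shiftProducts_maximal_ker`). If `Q` is any
bounded projection onto the finite-dimensional space `ker S`, then `S + Q` is injective, hence
invertible by Fredholm's alternative, and `P = Q (S + Q)⁻¹` (`exists_spectral_projection`). The two
growth estimates are Gelfand's spectral radius formula (`exists_isDominatedSplitting_complex`).
An operator commuting with `K` preserves the growth conditions that characterize `ker P` and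
`range P`, so it commutes with `P` (`IsDominatedSplitting.apply_comm`). This is applied twice: to
the real part on the complexification, which brings `P` down to the real space
(`exists_isDominatedSplitting`), and to the operators `T_t`.

The exponents are then defined from the growth rates alone: each is the supremum of the rates
strictly below the previous one. At a real exponent `a` the next slow space is `ker P`
(`C0Semigroup.IsSplitting.mem_slow_exponent_succ_iff`), outside `ker P` the lower growth rate is at
least `a`, and the fast space is `range P` intersected with the slow space of `a`
(`C0Semigroup.IsSplitting.isFastSpace`). It is unique because a vector with a backward orbit of rate
`-a` has no component in `ker P` (`C0Semigroup.IsSplitting.fastSpace_le`). The exponents tend to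
`-∞` since a real limit `L` would bound every codimension by the rank of the splitting at `L`.
-/

/-! ### Powers of Banach algebra elements with small spectrum -/

theorem exists_norm_pow_le_of_spectrum_lt {A : Type*} [NormedRing A] [NormedAlgebra ℂ A]
    [CompleteSpace A] (a : A) {ρ : ℝ} (hρ : 0 < ρ) (h : ∀ z ∈ spectrum ℂ a, ‖z‖ < ρ) :
    ∃ σ, 0 < σ ∧ σ < ρ ∧ ∃ C, 0 ≤ C ∧ ∀ n : ℕ, ‖a ^ n‖ ≤ C * σ ^ n := by
  rcases subsingleton_or_nontrivial A with hA | hA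
  · refine ⟨ρ / 2, by positivity, by linarith, 0, le_rfl, fun n => ?_⟩
    simp [Subsingleton.elim (a ^ n) 0]
  lift ρ to ℝ≥0 using hρ.le
  have h1 : spectralRadius ℂ a < (ρ : ℝ≥0∞) :=
    spectrum.spectralRadius_lt_of_forall_lt a fun z hz => by exact_mod_cast h z hz
  obtain ⟨s, hs1, hs2⟩ := ENNReal.lt_iff_exists_nnreal_btwn.1 h1
  have hspos : (0 : ℝ) < s := by exact_mod_cast (zero_le.trans_lt hs1 : (0 : ℝ≥0∞) < s)
  have hsρ : (s : ℝ) < ρ := by exact_mod_cast hs2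
  have hev : ∀ᶠ n : ℕ in atTop, ‖a ^ n‖ ≤ (s : ℝ) ^ n := by
    have hgelfand := spectrum.pow_nnnorm_pow_one_div_tendsto_nhds_spectralRadius a
    filter_upwards [hgelfand.eventually_lt_const hs1, eventually_gt_atTop 0] with n hn hn0
    have hn0' : (0 : ℝ) < n := by exact_mod_cast hn0
    have h2 := ENNReal.rpow_le_rpow hn.le hn0'.le
    rw [← ENNReal.rpow_mul, one_div, inv_mul_cancel₀ hn0'.ne', ENNReal.rpow_one,
      ENNReal.rpow_natCast] at h2
    exact_mod_cast h2
  obtain ⟨N, hN⟩ := eventually_atTop.1 hev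
  refine ⟨s, hspos, hsρ, 1 + ∑ k ∈ Finset.range N, ‖a ^ k‖ / (s : ℝ) ^ k, by positivity,
    fun n => ?_⟩
  have hsn : (0 : ℝ) < (s : ℝ) ^ n := pow_pos hspos n
  rcases lt_or_ge n N with hn | hn
  · have h3 : ‖a ^ n‖ / (s : ℝ) ^ n ≤ ∑ k ∈ Finset.range N, ‖a ^ k‖ / (s : ℝ) ^ k :=
      Finset.single_le_sum (f := fun k => ‖a ^ k‖ / (s : ℝ) ^ k) (fun k _ => by positivity)
        (Finset.mem_range.2 hn)
    rw [← div_le_iff₀ hsn]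
    linarith
  · have h3 : 0 ≤ ∑ k ∈ Finset.range N, ‖a ^ k‖ / (s : ℝ) ^ k :=
      Finset.sum_nonneg fun k _ => by positivity
    have h4 := hN n hn
    nlinarith [mul_nonneg h3 hsn.le]

/-! ### Riesz theory: the generalized eigenspaces for large eigenvalues -/

section Riesz

variable {E : Type*} [NormedAddCommGroup E] [NormedSpace ℂ E]

/-- The products of shifts `K - l`, `ρ ≤ ‖l‖`: the operators `p(K)` for monic polynomials `p`
all of whose roots have modulus at least `ρ`. -/
def shiftProducts (K : E →L[ℂ] E) (ρ : ℝ) : Submonoid (E →L[ℂ] E) :=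
  Submonoid.closure {S | ∃ l : ℂ, ρ ≤ ‖l‖ ∧ S = K - l • 1}

variable {K S : E →L[ℂ] E} {ρ : ℝ}

theorem shiftProducts_commute (hS : S ∈ shiftProducts K ρ) : Commute S K := by
  induction hS using Submonoid.closure_induction with
  | mem x hx =>
    obtain ⟨l, -, rfl⟩ := hx
    exact (Commute.refl K).sub_left ((Commute.one_left K).smul_left l)
  | one => exact Commute.one_left K
  | mul x y _ _ hx hy => exact hx.mul_left hy

/-- `p(K) x = p(μ) x` for an eigenvector `x` of `K`, and `p(μ) ≠ 0` if `μ` is not a root of `p`. -/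
theorem shiftProducts_apply_eigenvector (hS : S ∈ shiftProducts K ρ) {μ : ℂ} (hμ : ‖μ‖ < ρ) :
    ∃ c : ℂ, c ≠ 0 ∧ ∀ x, K x = μ • x → S x = c • x := by
  induction hS using Submonoid.closure_induction with
  | mem x hx =>
    obtain ⟨l, hl, rfl⟩ := hx
    refine ⟨μ - l, fun h => ?_, fun x hx => by simp [hx, sub_smul]⟩
    rw [sub_eq_zero.1 h] at hμ
    linarith
  | one => exact ⟨1, one_ne_zero, fun x _ => by simp⟩
  | mul x y _ _ hx hy =>
    obtain ⟨c, hc, h1⟩ := hx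
    obtain ⟨d, hd, h2⟩ := hy
    refine ⟨d * c, mul_ne_zero hd hc, fun z hz => ?_⟩
    simp [h2 z hz, h1 z hz, smul_smul]

/-- `p(K) - p(0)` is compact, and `p(0) ≠ 0`. -/
theorem shiftProducts_compact_perturbation (hK : IsCompactOperator K) (hρ : 0 < ρ)
    (hS : S ∈ shiftProducts K ρ) :
    ∃ c : ℂ, c ≠ 0 ∧ IsCompactOperator (S - c • 1 : E →L[ℂ] E) := by
  induction hS using Submonoid.closure_induction with
  | mem x hx =>
    obtain ⟨l, hl, rfl⟩ := hx
    refine ⟨-l, fun h => ?_, ?_⟩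
    · rw [neg_eq_zero.1 h, norm_zero] at hl
      linarith
    · have : (K - l • 1 - (-l) • 1 : E →L[ℂ] E) = K := by simp
      rwa [this]
  | one =>
    refine ⟨1, one_ne_zero, ?_⟩
    have : (1 - (1 : ℂ) • 1 : E →L[ℂ] E) = 0 := by simp
    rw [this]
    exact isCompactOperator_zero
  | mul x y _ _ hx hy =>
    obtain ⟨c, hc, h1⟩ := hx
    obtain ⟨d, hd, h2⟩ := hy
    refine ⟨c * d, mul_ne_zero hc hd, ?_⟩
    have : (x * y - (c * d) • 1 : E →L[ℂ] E) = (x - c • 1) * y + c • (y - d • 1) := by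
      rw [sub_mul, smul_sub, smul_smul]
      simp
    rw [this]
    exact (h1.comp_clm y).add (h2.smul c)

/-- Riesz's compactness argument: the kernels of the operators in `shiftProducts K ρ` cannot grow
forever, so one of them absorbs every further factor `K - l`, `ρ ≤ ‖l‖`. -/
theorem exists_shiftProducts_maximal_ker (hK : IsCompactOperator K) (hρ : 0 < ρ) :
    ∃ S ∈ shiftProducts K ρ, ∀ l : ℂ, ρ ≤ ‖l‖ → ∀ x, S (K x - l • x) = 0 → S x = 0 := by
  by_contra! hcon
  choose! l hl x hx hx' using hcon
  have hmul : ∀ S ∈ shiftProducts K ρ, S * (K - l S • 1) ∈ shiftProducts K ρ := fun S hS =>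
    mul_mem hS (Submonoid.subset_closure ⟨l S, hl S hS, rfl⟩)
  let s : ℕ → E →L[ℂ] E := fun n => Nat.rec 1 (fun _ S => S * (K - l S • 1)) n
  have hs1 : ∀ n, s (n + 1) = s n * (K - l (s n) • 1) := fun n => rfl
  have hs : ∀ n, s n ∈ shiftProducts K ρ := by
    intro n
    induction n with
    | zero => exact one_mem _
    | succ n ih => exact hmul _ ih
  have hsucc : ∀ n y, s n y = 0 → s (n + 1) y = 0 := by
    intro n y hy
    have h1 : s n (K y) = K (s n y) := congrArg (fun f : E →L[ℂ] E => f y)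
      (shiftProducts_commute (hs n)).eq
    simp [hs1, h1, hy]
  have hmono : ∀ m n, m ≤ n → ∀ y, s m y = 0 → s n y = 0 := by
    intro m n hmn y hy
    induction n, hmn using Nat.le_induction with
    | base => exact hy
    | succ n _ ih => exact hsucc n y ih
  -- Riesz's lemma inside `ker (s (n + 1))`, for its proper closed subspace `ker (s n)`
  have hw : ∀ n, ∃ w, s (n + 1) w = 0 ∧ ‖w‖ ≤ 3 ∧ ∀ y, s n y = 0 → 1 ≤ ‖w - y‖ := by
    intro n
    let V : Submodule ℂ E := (s (n + 1)).toLinearMap.ker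
    let F : Submodule ℂ V := ((s n).toLinearMap.ker).comap V.subtype
    have hF : IsClosed (F : Set V) := by
      have : (F : Set V) = (fun v : V => s n v) ⁻¹' {0} := by
        ext v; simp [F]
      rw [this]
      exact isClosed_singleton.preimage (by fun_prop)
    have hne : ∃ v : V, v ∉ F := by
      refine ⟨⟨x (s n), ?_⟩, ?_⟩
      · simpa [V, hs1] using hx (s n) (hs n)
      · simpa [F] using hx' (s n) (hs n)
    obtain ⟨v, hv1, hv2⟩ := riesz_lemma_of_norm_lt (c := (2 : ℂ)) (R := 3)
      (by simp) (by simp; norm_num) hF hne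
    refine ⟨v, v.2, hv1, fun y hy => ?_⟩
    have := hv2 ⟨y, hsucc n y hy⟩ (by simpa [F] using hy)
    simpa using this
  choose w hw1 hw2 hw3 using hw
  have hsep : ∀ j k, j < k → ρ ≤ ‖K (w k) - K (w j)‖ := by
    intro j k hjk
    have hlk : l (s k) ≠ 0 := fun h => by
      have := hl (s k) (hs k)
      rw [h, norm_zero] at this
      linarith
    have hj : s k (w j) = 0 := hmono (j + 1) k hjk _ (hw1 j)
    have hj' : s k (K (w j)) = 0 := by
      have h1 : s k (K (w j)) = K (s k (w j)) := congrArg (fun f : E →L[ℂ] E => f (w j))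
        (shiftProducts_commute (hs k)).eq
      rw [h1, hj, map_zero]
    have hk : s k (K (w k) - l (s k) • w k) = 0 := by
      have := hw1 k
      rw [hs1] at this
      simpa using this
    have h2 := hw3 k ((l (s k))⁻¹ • (K (w j) - (K (w k) - l (s k) • w k))) (by
      rw [map_smul, map_sub, hj', hk]; simp)
    have h3 : K (w k) - K (w j) =
        l (s k) • (w k - (l (s k))⁻¹ • (K (w j) - (K (w k) - l (s k) • w k))) := by
      rw [smul_sub, smul_inv_smul₀ hlk]
      abel
    rw [h3, norm_smul]
    calc ρ ≤ ‖l (s k)‖ * 1 := by rw [mul_one]; exact hl _ (hs k)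
      _ ≤ _ := by gcongr
  obtain ⟨D, hD, hD'⟩ := hK.image_closedBall_subset_compact 3
  obtain ⟨y, -, ψ, hψ, hψy⟩ := hD.tendsto_subseq
    (fun n => hD' ⟨w n, by simpa using hw2 n, rfl⟩)
  have hc := hψy.cauchySeq
  rw [Metric.cauchySeq_iff'] at hc
  obtain ⟨N, hN⟩ := hc ρ hρ
  have h1 : ‖K (w (ψ (N + 1))) - K (w (ψ N))‖ < ρ := by
    simpa [dist_eq_norm_sub] using hN (N + 1) (by simp)
  exact h1.not_ge (hsep _ _ (hψ (Nat.lt_succ_self N)))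

theorem finiteDimensional_ker_of_compact_perturbation {c : ℂ} (hc : c ≠ 0)
    (hS : IsCompactOperator (S - c • 1 : E →L[ℂ] E)) :
    FiniteDimensional ℂ S.toLinearMap.ker := by
  let V : Submodule ℂ E := S.toLinearMap.ker
  have hV : IsClosed (V : Set E) := S.isClosed_ker
  have hmaps : ∀ v ∈ V, (S - c • 1 : E →L[ℂ] E).toLinearMap v ∈ V := by
    intro v hv
    have hv' : S v = 0 := hv
    change S ((S - c • 1 : E →L[ℂ] E) v) = 0
    simp [hv']
  have h1 : IsCompactOperator ((S - c • 1 : E →L[ℂ] E).toLinearMap.restrict hmaps) :=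
    IsCompactOperator.restrict hS hmaps hV
  have h2 := h1.smul (-c)⁻¹
  refine FiniteDimensional.of_isCompactOperator_id (E := V) (𝕜 := ℂ) ?_
  have h3 : (id : V → V) =
      (-c)⁻¹ • ((S - c • 1 : E →L[ℂ] E).toLinearMap.restrict hmaps : V → V) := by
    funext v
    refine Subtype.ext ?_
    simp [smul_smul, hc]
  rw [h3]
  exact h2

/-- The spectral projection of a compact operator for the eigenvalues of modulus at least `ρ`:
on its kernel `K` has no such eigenvalue, and on its range no other. -/
theorem exists_spectral_projection [CompleteSpace E] (hK : IsCompactOperator K) (hρ : 0 < ρ) :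
    ∃ P : E →L[ℂ] E, P * P = P ∧ P * K = K * P ∧ FiniteDimensional ℂ P.toLinearMap.range ∧
      (∀ (μ : ℂ) (x : E), K x = μ • x → P x = 0 → x ≠ 0 → ‖μ‖ < ρ) ∧
      (∀ (μ : ℂ) (x : E), K x = μ • x → P x = x → x ≠ 0 → ρ ≤ ‖μ‖) := by
  obtain ⟨S, hS, hmax⟩ := exists_shiftProducts_maximal_ker hK hρ
  obtain ⟨c, hc, hcomp⟩ := shiftProducts_compact_perturbation hK hρ hS
  have hcomm : ∀ x, S (K x) = K (S x) := fun x => congrArg (fun f : E →L[ℂ] E => f x)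
    (shiftProducts_commute hS).eq
  -- `S` absorbs every further factor, in particular `ker (S * S) = ker S`
  have habs : ∀ R ∈ shiftProducts K ρ, ∀ x, S (R x) = 0 → S x = 0 := by
    intro R hR
    induction hR using Submonoid.closure_induction with
    | mem R hR =>
      obtain ⟨l, hl, rfl⟩ := hR
      exact fun x hx => hmax l hl x (by simpa using hx)
    | one => exact fun x hx => by simpa using hx
    | mul R₁ R₂ _ _ h₁ h₂ => exact fun x hx => h₂ x (h₁ _ (by simpa using hx))
  have hfin : FiniteDimensional ℂ S.toLinearMap.ker :=
    finiteDimensional_ker_of_compact_perturbation hc hcomp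
  obtain ⟨q, hq⟩ := Submodule.ClosedComplemented.of_finiteDimensional (𝕜 := ℂ) S.toLinearMap.ker
  let Q : E →L[ℂ] E := S.toLinearMap.ker.subtypeL.comp q
  have hQS : ∀ x, S (Q x) = 0 := fun x => (q x).2
  have hQ : ∀ x, S x = 0 → Q x = x := fun x hx => congrArg Subtype.val (hq ⟨x, hx⟩)
  have := LocallyCompactSpace.of_finiteDimensional_of_complete ℂ S.toLinearMap.ker
  have hQc : IsCompactOperator Q :=
    (isCompactOperator_of_locallyCompactSpace_rng S.toLinearMap.ker.subtypeL).comp_clm q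
  -- `S + Q` is injective, since `ker S ∩ range S = 0`; by Fredholm's alternative it is invertible
  have hinj : ∀ x, S x + Q x = 0 → x = 0 := by
    intro x hx
    have h1 : S (S x) = 0 := by
      rw [eq_neg_of_add_eq_zero_left hx, map_neg, hQS, neg_zero]
    have h2 := habs S hS x h1
    rw [h2, zero_add, hQ x h2] at hx
    exact hx
  have hunit : IsUnit (S + Q) := by
    have hT : IsCompactOperator (-((S - c • 1) + Q) : E →L[ℂ] E) := (hcomp.add hQc).neg
    rcases hT.hasEigenvalue_or_mem_resolventSet hc with h | h
    · obtain ⟨x, hx⟩ := h.exists_hasEigenvector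
      refine absurd (hinj x ?_) hx.2
      have h1 := hx.apply_eq_smul
      simp only [ContinuousLinearMap.coe_coe, neg_apply, add_apply, sub_apply, smul_apply,
        one_apply_eq_self] at h1
      have h2 : S x + Q x = c • x - -(S x - c • x + Q x) := by abel
      rw [h2, h1, sub_self]
    · rw [spectrum.mem_resolventSet_iff] at h
      convert h using 1
      rw [Algebra.algebraMap_eq_smul_one]
      abel
  obtain ⟨u, hu⟩ := hunit
  -- with `N = (S + Q)⁻¹`, `Q N` is the projection onto `ker S` along `range S`
  let N : E →L[ℂ] E := ((u⁻¹ : (E →L[ℂ] E)ˣ) : E →L[ℂ] E)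
  have hN1 : ∀ x, S (N x) + Q (N x) = x := fun x => by
    have := congrArg (fun f : E →L[ℂ] E => f x) u.mul_inv
    rw [hu] at this
    simpa using this
  have hN2 : ∀ x, N (S x + Q x) = x := fun x => by
    have := congrArg (fun f : E →L[ℂ] E => f x) u.inv_mul
    rw [hu] at this
    simpa using this
  have hP1 : ∀ x, S x = 0 → Q (N x) = x := by
    intro x hx
    have h := hN2 x
    rw [hx, zero_add, hQ x hx] at h
    rw [h, hQ x hx]
  have hP2 : ∀ y, Q (N (S y)) = 0 := by
    intro y
    have h := hN2 (y - Q y)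
    rw [map_sub, map_sub, hQS, hQ (Q y) (hQS y), sub_self, sub_zero, add_zero] at h
    rw [h, map_sub, hQ (Q y) (hQS y), sub_self]
  have hdec : ∀ x, x = S (N x) + Q (N x) := fun x => (hN1 x).symm
  refine ⟨Q * N, ?_, ?_, ?_, ?_, ?_⟩
  · ext x
    exact hP1 _ (hQS _)
  · ext x
    change Q (N (K x)) = K (Q (N x))
    conv_lhs => rw [hdec x]
    rw [map_add, ← hcomm, map_add, map_add, hP2, zero_add]
    exact hP1 _ (by rw [hcomm, hQS, map_zero])
  · refine Submodule.finiteDimensional_of_le (S₂ := S.toLinearMap.ker) ?_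
    rintro _ ⟨x, rfl⟩
    exact hQS _
  · intro μ x hx hPx hx0
    by_contra! hμ
    refine hx0 ?_
    have hPx' : Q (N x) = 0 := hPx
    have hxS : x = S (N x) := by
      have := hdec x
      rwa [hPx', add_zero] at this
    have hSS : S (S (N x)) = 0 := by
      refine congrArg S (hmax μ hμ (N x) ?_) |>.trans (map_zero S)
      rw [map_sub, hcomm, map_smul, ← hxS, hx, sub_self]
    rw [hxS]
    exact habs S hS _ hSS
  · intro μ x hx hPx hx0
    by_contra! hμ
    obtain ⟨d, hd, h⟩ := shiftProducts_apply_eigenvector hS hμ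
    have h1 : S x = 0 := by rw [← hPx]; exact hQS _
    rw [h x hx] at h1
    exact (smul_ne_zero hd hx0) h1

end Riesz

/-! ### Dominated splittings -/

/-- The projection `P` commutes with `K` and has finite rank, and it splits the space at the growth
rate `ρ`: on `ker P` the powers of `K` are bounded by those of some `σ < ρ`, and on `range P` they
grow at least like those of every `b < ρ`. -/
structure IsDominatedSplitting {𝕜 E : Type*} [NormedField 𝕜] [NormedAddCommGroup E]
    [NormedSpace 𝕜 E] (K P : E →L[𝕜] E) (ρ : ℝ) : Prop where
  idem : P * P = P
  comm : P * K = K * P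
  finiteDimensional : FiniteDimensional 𝕜 P.toLinearMap.range
  contract : ∃ σ, 0 < σ ∧ σ < ρ ∧ ∃ C, 0 ≤ C ∧
    ∀ (n : ℕ) (x : E), ‖(K ^ n) (x - P x)‖ ≤ C * σ ^ n * ‖x‖
  expand : ∀ b, 0 < b → b < ρ → ∃ C, 0 ≤ C ∧
    ∀ (n : ℕ) (x : E), b ^ n * ‖P x‖ ≤ C * ‖(K ^ n) (P x)‖

/-- A compact operator on a complex Banach space has a dominated splitting at every positive rate.
Both estimates are Gelfand's formula, for the operators `K (1 - P)` and `(K P + ρ (1 - P))⁻¹`. -/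
theorem exists_isDominatedSplitting_complex {E : Type*} [NormedAddCommGroup E] [NormedSpace ℂ E]
    [CompleteSpace E] {K : E →L[ℂ] E} (hK : IsCompactOperator K) {ρ : ℝ} (hρ : 0 < ρ) :
    ∃ P : E →L[ℂ] E, IsDominatedSplitting K P ρ := by
  obtain ⟨P, hPP, hPK, hfin, hslow, hfast⟩ := exists_spectral_projection hK hρ
  have hPP' : ∀ x, P (P x) = P x := fun x => congrArg (fun f : E →L[ℂ] E => f x) hPP
  have hPK' : ∀ x, P (K x) = K (P x) := fun x => congrArg (fun f : E →L[ℂ] E => f x) hPK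
  refine ⟨P, hPP, hPK, hfin, ?_, ?_⟩
  -- `D` agrees with `K` on `ker P` and kills `range P`
  · let D : E →L[ℂ] E := K * (1 - P)
    have hD : ∀ x, D x = K x - K (P x) := fun x => by simp [D]
    have hDc : IsCompactOperator D := hK.comp_clm (1 - P)
    have hspec : ∀ z ∈ spectrum ℂ D, ‖z‖ < ρ := by
      intro z hz
      by_cases hz0 : z = 0
      · simpa [hz0] using hρ
      obtain ⟨x, hx⟩ := ((hDc.hasEigenvalue_iff_mem_spectrum hz0).2 hz).exists_hasEigenvector
      have h1 : D x = z • x := hx.apply_eq_smul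
      rw [hD] at h1
      have h2 : P x = 0 := by
        have : z • P x = 0 := by rw [← map_smul, ← h1, map_sub, hPK', hPK', hPP', sub_self]
        exact (smul_eq_zero.1 this).resolve_left hz0
      rw [h2, map_zero, sub_zero] at h1
      exact hslow z x h1 h2 hx.2
    obtain ⟨σ, hσ0, hσ, C, hC, h⟩ := exists_norm_pow_le_of_spectrum_lt D hρ hspec
    have hpow : ∀ (n : ℕ) (y : E), P y = 0 → (K ^ n) y = (D ^ n) y := by
      intro n
      induction n with
      | zero => intro y _; simp
      | succ n ih =>
        intro y hy
        have h1 : D y = K y := by rw [hD, hy, map_zero, sub_zero]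
        have h2 := ih (K y) (by rw [hPK', hy, map_zero])
        rw [pow_succ, pow_succ]
        change (K ^ n) (K y) = (D ^ n) (D y)
        rw [h1, h2]
    refine ⟨σ, hσ0, hσ, C * ‖(1 - P : E →L[ℂ] E)‖, by positivity, fun n x => ?_⟩
    rw [hpow n (x - P x) (by rw [map_sub, hPP', sub_self])]
    have h1 : ‖x - P x‖ ≤ ‖(1 - P : E →L[ℂ] E)‖ * ‖x‖ := (1 - P : E →L[ℂ] E).le_opNorm x
    calc ‖(D ^ n) (x - P x)‖ ≤ ‖D ^ n‖ * ‖x - P x‖ := (D ^ n).le_opNorm _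
      _ ≤ (C * σ ^ n) * (‖(1 - P : E →L[ℂ] E)‖ * ‖x‖) := by gcongr; exact h n
      _ = _ := by ring
  · intro b hb hbρ
    -- `M` agrees with `K` on `range P` and is `ρ` on `ker P`
    let M : E →L[ℂ] E := (ρ : ℂ) • 1 + (K - (ρ : ℂ) • 1) * P
    have hρ0 : (ρ : ℂ) ≠ 0 := by exact_mod_cast hρ.ne'
    have hρn : ‖(ρ : ℂ)‖ = ρ := by simp [abs_of_pos hρ]
    have : LocallyCompactSpace P.toLinearMap.range := .of_finiteDimensional_of_complete ℂ _
    have hPc : IsCompactOperator P := by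
      have h1 := (isCompactOperator_of_locallyCompactSpace_rng
        P.toLinearMap.range.subtypeL).comp_clm
          (P.codRestrict P.toLinearMap.range fun x => ⟨x, rfl⟩)
      exact h1
    have hcomp : IsCompactOperator ((K - (ρ : ℂ) • 1) * P : E →L[ℂ] E) := by
      have h1 := hPc.clm_comp (K - (ρ : ℂ) • 1)
      exact h1
    have hspecM : ∀ z ∈ spectrum ℂ M, ρ ≤ ‖z‖ := by
      intro z hz
      by_cases hzρ : z = ρ
      · rw [hzρ, hρn]
      have hz' : z - ρ ∈ spectrum ℂ ((K - (ρ : ℂ) • 1) * P : E →L[ℂ] E) := by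
        rw [spectrum.mem_iff] at hz ⊢
        convert hz using 2
        simp only [Algebra.algebraMap_eq_smul_one, M, sub_smul]
        abel
      have hne : z - ρ ≠ 0 := sub_ne_zero.2 hzρ
      obtain ⟨x, hx⟩ := ((hcomp.hasEigenvalue_iff_mem_spectrum hne).2 hz').exists_hasEigenvector
      have h1 : K (P x) - (ρ : ℂ) • P x = (z - ρ) • x := hx.apply_eq_smul
      have h2 : P x = x := by
        have : (z - ρ) • P x = (z - ρ) • x := by
          rw [← map_smul, ← h1, map_sub, hPK', map_smul, hPP']
        exact smul_right_injective E hne this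
      rw [h2, sub_smul, sub_left_inj] at h1
      exact hfast z x h1 h2 hx.2
    have hMu : IsUnit M := by
      by_contra hcon
      have := hspecM 0 (spectrum.zero_mem ℂ hcon)
      rw [norm_zero] at this
      linarith
    obtain ⟨u, hu⟩ := hMu
    have hspec : ∀ z ∈ spectrum ℂ ((u⁻¹ : (E →L[ℂ] E)ˣ) : E →L[ℂ] E), ‖z‖ < b⁻¹ := by
      intro z hz
      have hz0 : z ≠ 0 := spectrum.ne_zero_of_mem_of_unit hz
      have h1 : z⁻¹ ∈ spectrum ℂ M := by
        have := (spectrum.inv_mem_iff (R := ℂ) (r := Units.mk0 z hz0) (a := u⁻¹)).1 hz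
        rw [inv_inv, hu] at this
        simpa using this
      have h2 := hspecM _ h1
      rw [norm_inv] at h2
      have h3 : 0 < ‖z‖ := norm_pos_iff.2 hz0
      exact (lt_inv_comm₀ h3 hb).2 (hbρ.trans_le h2)
    obtain ⟨σ, hσ0, hσ, C, hC, h⟩ := exists_norm_pow_le_of_spectrum_lt
      ((u⁻¹ : (E →L[ℂ] E)ˣ) : E →L[ℂ] E) (inv_pos.2 hb) hspec
    have hM : ∀ y, P y = y → M y = K y := by
      intro y hy
      simp [M, hy]
    have hpow : ∀ (n : ℕ) (y : E), P y = y → (K ^ n) y = (M ^ n) y := by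
      intro n
      induction n with
      | zero => intro y _; simp
      | succ n ih =>
        intro y hy
        have h2 := ih (K y) (by rw [hPK', hy])
        rw [pow_succ, pow_succ]
        change (K ^ n) (K y) = (M ^ n) (M y)
        rw [hM y hy, h2]
    refine ⟨C, hC, fun n x => ?_⟩
    have h1 : ((((u⁻¹ : (E →L[ℂ] E)ˣ) : E →L[ℂ] E)) ^ n) ((K ^ n) (P x)) = P x := by
      rw [hpow n _ (hPP' x), ← hu, ← Units.val_pow_eq_pow_val, ← Units.val_pow_eq_pow_val]
      have := congrArg (fun f : E →L[ℂ] E => f (P x)) (u ^ n).inv_mul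
      rw [← inv_pow] at this
      simpa using this
    have h2 : ‖P x‖ ≤ C * σ ^ n * ‖(K ^ n) (P x)‖ := by
      conv_lhs => rw [← h1]
      refine (ContinuousLinearMap.le_opNorm _ _).trans ?_
      gcongr
      exact h n
    calc b ^ n * ‖P x‖ ≤ b ^ n * (C * σ ^ n * ‖(K ^ n) (P x)‖) := by gcongr
      _ = (b * σ) ^ n * (C * ‖(K ^ n) (P x)‖) := by rw [mul_pow]; ring
      _ ≤ 1 * (C * ‖(K ^ n) (P x)‖) := by
        gcongr
        refine pow_le_one₀ (by positivity) ?_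
        calc b * σ ≤ b * b⁻¹ := by gcongr
          _ = 1 := mul_inv_cancel₀ hb.ne'
      _ = _ := one_mul _

/-! ### Operators commuting with a dominated splitting -/

theorem eq_zero_of_norm_le_geometric {E : Type*} [NormedAddCommGroup E] {z : E} {D q : ℝ}
    (hq0 : 0 ≤ q) (hq : q < 1) (h : ∀ n : ℕ, ‖z‖ ≤ D * q ^ n) : z = 0 := by
  have h1 : Tendsto (fun n : ℕ => D * q ^ n) atTop (𝓝 0) := by
    simpa using (tendsto_pow_atTop_nhds_zero_of_lt_one hq0 hq).const_mul D
  exact norm_le_zero_iff.1 (ge_of_tendsto' h1 h)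

namespace IsDominatedSplitting

section

variable {𝕜 E : Type*} [NontriviallyNormedField 𝕜] [NormedAddCommGroup E] [NormedSpace 𝕜 E]
  {K P R : E →L[𝕜] E} {ρ : ℝ}

theorem apply_apply (h : IsDominatedSplitting K P ρ) (x : E) : P (P x) = P x :=
  congrArg (fun f : E →L[𝕜] E => f x) h.idem

theorem apply_comm_pow (h : IsDominatedSplitting K P ρ) (n : ℕ) (x : E) :
    P ((K ^ n) x) = (K ^ n) (P x) :=
  congrArg (fun f : E →L[𝕜] E => f x) (Commute.pow_right (show Commute P K from h.comm) n).eq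

/-- Every vector of `range P` has backward orbits in `range P`: on this finite-dimensional space `K`
is injective, hence bijective. -/
theorem exists_pow_apply_eq (h : IsDominatedSplitting K P ρ) (hρ : 0 < ρ) (n : ℕ) (x : E) :
    ∃ y, (K ^ n) (P y) = P x := by
  have := h.finiteDimensional
  have hmaps : ∀ v ∈ P.toLinearMap.range, (K ^ n).toLinearMap v ∈ P.toLinearMap.range := by
    rintro _ ⟨v, rfl⟩
    exact ⟨(K ^ n) v, h.apply_comm_pow n v⟩
  let L := (K ^ n).toLinearMap.restrict hmaps
  have hinj : Function.Injective L := by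
    rw [injective_iff_map_eq_zero]
    rintro ⟨_, ⟨v, rfl⟩⟩ hv
    have hv' : (K ^ n) (P v) = 0 := congrArg Subtype.val hv
    obtain ⟨C, -, hC⟩ := h.expand (ρ / 2) (by positivity) (by linarith)
    have h1 := hC n v
    rw [hv', norm_zero, mul_zero] at h1
    have h2 : ‖P v‖ ≤ 0 := by
      by_contra! h3
      have : 0 < (ρ / 2) ^ n * ‖P v‖ := by positivity
      linarith
    exact Subtype.ext (norm_le_zero_iff.1 h2)
  obtain ⟨⟨_, ⟨y, rfl⟩⟩, hy⟩ := LinearMap.surjective_of_injective hinj ⟨P x, ⟨x, rfl⟩⟩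
  exact ⟨y, congrArg Subtype.val hy⟩

/-- An operator that commutes with `K` preserves both the forward growth that characterizes `ker P`
and the backward decay that characterizes `range P`. -/
theorem apply_comm (h : IsDominatedSplitting K P ρ) (hρ : 0 < ρ) (hR : R * K = K * R) (x : E) :
    P (R x) = R (P x) := by
  obtain ⟨σ, hσ0, hσ, C, hC, hcon⟩ := h.contract
  obtain ⟨b, hσb, hbρ⟩ := exists_between hσ
  have hb : 0 < b := hσ0.trans hσb
  obtain ⟨C', hC', hexp⟩ := h.expand b hb hbρ
  have hRn : ∀ (n : ℕ) y, (K ^ n) (R y) = R ((K ^ n) y) := fun n y =>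
    congrArg (fun f : E →L[𝕜] E => f y) (Commute.pow_right (show Commute R K from hR) n).eq.symm
  have hq0 : 0 ≤ σ / b := by positivity
  have hq1 : σ / b < 1 := (div_lt_one hb).2 hσb
  -- pull `P y` back along `K ^ n`, then push its component in `ker P` forward again
  have h1 : ∀ y, R (P y) - P (R (P y)) = 0 := by
    intro y
    refine eq_zero_of_norm_le_geometric (D := C * (‖R‖ * (C' * ‖P y‖))) hq0 hq1 fun n => ?_
    obtain ⟨u, hu⟩ := h.exists_pow_apply_eq hρ n y
    have h2 : ‖P u‖ ≤ C' * ‖P y‖ / b ^ n := by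
      rw [le_div_iff₀ (by positivity), ← hu, mul_comm]
      exact hexp n u
    have h3 : R (P y) - P (R (P y)) = (K ^ n) (R (P u) - P (R (P u))) := by
      rw [map_sub, ← h.apply_comm_pow, hRn, hu]
    rw [h3]
    calc ‖(K ^ n) (R (P u) - P (R (P u)))‖ ≤ C * σ ^ n * ‖R (P u)‖ := hcon n _
      _ ≤ C * σ ^ n * (‖R‖ * (C' * ‖P y‖ / b ^ n)) := by
        gcongr
        exact (R.le_opNorm _).trans (by gcongr)
      _ = _ := by rw [div_pow]; ring
  -- `K ^ n` contracts `y - P y` faster than it can contract `P (R (y - P y))`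
  have h2 : ∀ y, P (R (y - P y)) = 0 := by
    intro y
    refine eq_zero_of_norm_le_geometric (D := C' * (‖P‖ * (‖R‖ * (C * ‖y‖)))) hq0 hq1 fun n => ?_
    have h3 := hexp n (R (y - P y))
    rw [← h.apply_comm_pow, hRn] at h3
    have h4 : ‖P (R ((K ^ n) (y - P y)))‖ ≤ ‖P‖ * (‖R‖ * (C * σ ^ n * ‖y‖)) := by
      refine (P.le_opNorm _).trans ?_
      gcongr
      refine (R.le_opNorm _).trans ?_
      gcongr
      exact hcon n y
    have h5 : ‖P (R (y - P y))‖ ≤ C' * (‖P‖ * (‖R‖ * (C * σ ^ n * ‖y‖))) / b ^ n := by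
      rw [le_div_iff₀ (by positivity), mul_comm]
      exact h3.trans (by gcongr)
    refine h5.trans_eq ?_
    rw [div_pow]
    ring
  have h3 := h2 x
  rw [map_sub, map_sub, sub_eq_zero] at h3
  rw [h3]
  exact (sub_eq_zero.1 (h1 x)).symm

end

theorem restrictScalars {E : Type*} [NormedAddCommGroup E] [NormedSpace ℂ E] [NormedSpace ℝ E]
    [IsScalarTower ℝ ℂ E] {K P : E →L[ℂ] E} {ρ : ℝ} (h : IsDominatedSplitting K P ρ) :
    IsDominatedSplitting (K.restrictScalars ℝ) (P.restrictScalars ℝ) ρ := by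
  have hpow : ∀ (n : ℕ) x, ((K.restrictScalars ℝ) ^ n) x = (K ^ n) x := by
    intro n
    induction n with
    | zero => intro x; simp
    | succ n ih =>
      intro x
      rw [pow_succ, pow_succ]
      exact ih (K x)
  refine ⟨?_, ?_, ?_, ?_, ?_⟩
  · ext x
    exact h.apply_apply x
  · ext x
    exact congrArg (fun f : E →L[ℂ] E => f x) h.comm
  · have := h.finiteDimensional
    have h1 : FiniteDimensional ℝ P.toLinearMap.range := FiniteDimensional.trans ℝ ℂ _
    exact h1
  · simpa only [hpow] using! h.contract
  · simpa only [hpow] using! h.expand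

end IsDominatedSplitting

/-! ### Complexification -/

/-- The complexification of a real normed space, realized as the space of real-linear maps
`ℂ → B` with complex scalars acting on the argument; the operator norm is a complex norm. -/
def Complexification (B : Type*) [NormedAddCommGroup B] [NormedSpace ℝ B] : Type _ := ℂ →L[ℝ] B

namespace Complexification

variable {B : Type*} [NormedAddCommGroup B] [NormedSpace ℝ B]

noncomputable instance : NormedAddCommGroup (Complexification B) :=
  inferInstanceAs (NormedAddCommGroup (ℂ →L[ℝ] B))

noncomputable instance : NormedSpace ℝ (Complexification B) :=
  inferInstanceAs (NormedSpace ℝ (ℂ →L[ℝ] B))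

instance [CompleteSpace B] : CompleteSpace (Complexification B) :=
  inferInstanceAs (CompleteSpace (ℂ →L[ℝ] B))

noncomputable instance : SMul ℂ (Complexification B) where
  smul z f := ContinuousLinearMap.comp (show ℂ →L[ℝ] B from f) (ContinuousLinearMap.mul ℝ ℂ z)

/-- The value at `w` of an element of the complexification, as a real-linear map. -/
noncomputable def eval (w : ℂ) : Complexification B →L[ℝ] B := ContinuousLinearMap.apply ℝ B w

@[ext]
theorem ext_eval {f g : Complexification B} (h : ∀ w, eval w f = eval w g) : f = g :=
  ContinuousLinearMap.ext h

@[simp]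
theorem eval_smul (w z : ℂ) (f : Complexification B) : eval w (z • f) = eval (z * w) f := rfl

theorem eval_eq (w : ℂ) (f : Complexification B) :
    eval w f = w.re • eval 1 f + w.im • eval Complex.I f := by
  have h1 : ∀ w, eval w f = (show ℂ →L[ℝ] B from f) w := fun _ => rfl
  rw [h1, h1, h1, ← map_smul, ← map_smul, ← map_add]
  congr 1
  apply Complex.ext <;> simp

theorem norm_eval_le (w : ℂ) (f : Complexification B) : ‖eval w f‖ ≤ ‖f‖ * ‖w‖ :=
  ContinuousLinearMap.le_opNorm (show ℂ →L[ℝ] B from f) w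

noncomputable instance : NormedSpace ℂ (Complexification B) where
  one_smul f := by ext w; simp
  mul_smul z y f := by ext w; simp [mul_left_comm, mul_assoc]
  smul_zero z := by ext w; simp
  smul_add z f g := by ext w; simp
  add_smul z y f := by
    ext w
    have h1 : ∀ w, eval w f = (show ℂ →L[ℝ] B from f) w := fun _ => rfl
    simp only [eval_smul, map_add, add_mul]
    rw [h1, h1, h1, map_add]
  zero_smul f := by
    ext w
    have h1 : ∀ w, eval w f = (show ℂ →L[ℝ] B from f) w := fun _ => rfl
    simp only [eval_smul, map_zero, zero_mul]
    rw [h1, map_zero]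
  norm_smul_le z f := by
    refine ContinuousLinearMap.opNorm_le_bound _ (by positivity) fun w => ?_
    change ‖eval (z * w) f‖ ≤ _
    refine (norm_eval_le _ f).trans_eq ?_
    rw [norm_mul]
    ring

instance : IsScalarTower ℝ ℂ (Complexification B) where
  smul_assoc a z f := by
    ext w
    have h1 : ∀ w, eval w f = (show ℂ →L[ℝ] B from f) w := fun _ => rfl
    simp only [eval_smul, map_smul]
    rw [h1, h1, smul_mul_assoc, map_smul]

/-- The inclusion of the real space. -/
noncomputable def incl : B →L[ℝ] Complexification B :=
  ContinuousLinearMap.smulRightL ℝ ℂ B Complex.reCLM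

@[simp]
theorem eval_incl (w : ℂ) (x : B) : eval w (incl x) = w.re • x := rfl

/-- The complex-linear extension of a real-linear operator. -/
noncomputable def map (K : B →L[ℝ] B) : Complexification B →L[ℂ] Complexification B :=
  LinearMap.mkContinuous
    { toFun := fun f => K.comp (show ℂ →L[ℝ] B from f)
      map_add' := fun f g => by
        apply ContinuousLinearMap.ext
        intro w
        exact map_add K _ _
      map_smul' := fun _ _ => rfl } ‖K‖
    fun f => ContinuousLinearMap.opNorm_comp_le K (show ℂ →L[ℝ] B from f)

@[simp]
theorem eval_map (K : B →L[ℝ] B) (w : ℂ) (f : Complexification B) :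
    eval w (map K f) = K (eval w f) := rfl

theorem map_incl (K : B →L[ℝ] B) (x : B) : map K (incl x) = incl (K x) := by
  ext w
  simp

theorem isCompactOperator_map {K : B →L[ℝ] B} (hK : IsCompactOperator K) :
    IsCompactOperator (map K) := by
  -- `f = f(1) + (-i) f(i)`
  let J : Complexification B →L[ℂ] Complexification B := (-Complex.I) • 1
  have h1 : IsCompactOperator (fun f : Complexification B => incl (K (eval 1 f))) :=
    (hK.comp_clm (eval 1)).clm_comp (incl (B := B))
  have h2 : IsCompactOperator (fun f : Complexification B => J (incl (K (eval Complex.I f)))) :=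
    ((hK.comp_clm (eval Complex.I)).clm_comp (incl (B := B))).clm_comp J
  have h3 : (map K : Complexification B → Complexification B) =
      (fun f => incl (K (eval 1 f))) + fun f => J (incl (K (eval Complex.I f))) := by
    funext f
    ext w
    rw [Pi.add_apply, map_add, eval_map, eval_eq w f]
    simp [J]
  rw [h3]
  exact h1.add h2

end Complexification

/-- A compact operator on a real Banach space has a dominated splitting at every positive rate. -/
theorem exists_isDominatedSplitting {B : Type*} [NormedAddCommGroup B] [NormedSpace ℝ B]
    [CompleteSpace B] {K : B →L[ℝ] B} (hK : IsCompactOperator K) {ρ : ℝ} (hρ : 0 < ρ) :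
    ∃ P : B →L[ℝ] B, IsDominatedSplitting K P ρ := by
  obtain ⟨P', hP'⟩ := exists_isDominatedSplitting_complex
    (Complexification.isCompactOperator_map hK) hρ
  replace hP' := hP'.restrictScalars
  set K' := (Complexification.map K).restrictScalars ℝ with hK'
  set P := P'.restrictScalars ℝ with hP
  let ι : B →L[ℝ] Complexification B := Complexification.incl
  let π : Complexification B →L[ℝ] B := Complexification.eval 1
  have hπι : ∀ x, π (ι x) = x := fun x => by simp [π, ι]
  have hKι : ∀ (n : ℕ) x, (K' ^ n) (ι x) = ι ((K ^ n) x) := by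
    intro n
    induction n with
    | zero => intro x; simp
    | succ n ih =>
      intro x
      rw [pow_succ, pow_succ]
      change (K' ^ n) (Complexification.map K (ι x)) = ι ((K ^ n) (K x))
      rw [Complexification.map_incl]
      exact ih (K x)
  have hKπ : ∀ (n : ℕ) f, π ((K' ^ n) f) = (K ^ n) (π f) := by
    intro n
    induction n with
    | zero => intro x; simp
    | succ n ih =>
      intro x
      rw [pow_succ, pow_succ]
      exact ih (Complexification.map K x)
  -- `P` commutes with the real-linear map `x + i y ↦ x`, hence respects the real space
  have hJ : ∀ f, P (ι (π f)) = ι (π (P f)) := by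
    refine hP'.apply_comm hρ (R := ι.comp π) ?_
    ext1 f
    have h1 := hKι 1 (π f)
    have h2 := hKπ 1 f
    simp only [pow_one] at h1 h2
    change ι (π (K' f)) = K' (ι (π f))
    rw [h1, h2]
  have hPι : ∀ x, P (ι x) = ι (π (P (ι x))) := fun x => by
    have := hJ (ι x)
    rwa [hπι] at this
  refine ⟨π.comp (P.comp ι), ?_, ?_, ?_, ?_, ?_⟩
  · ext x
    change π (P (ι (π (P (ι x))))) = π (P (ι x))
    rw [← hPι, hP'.apply_apply]
  · ext x
    have h1 := hKι 1 x
    have h2 := hKπ 1 (P (ι x))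
    have h3 := hP'.apply_comm_pow 1 (ι x)
    simp only [pow_one] at h1 h2 h3
    change π (P (ι (K x))) = K (π (P (ι x)))
    rw [← h1, h3, h2]
  · have := hP'.finiteDimensional
    have h1 : FiniteDimensional ℝ (P.toLinearMap.range.map π.toLinearMap) := inferInstance
    refine Submodule.finiteDimensional_of_le (S₂ := P.toLinearMap.range.map π.toLinearMap) ?_
    rintro _ ⟨x, rfl⟩
    exact ⟨P (ι x), ⟨ι x, rfl⟩, rfl⟩
  · obtain ⟨σ, hσ0, hσ, C, hC, h⟩ := hP'.contract
    refine ⟨σ, hσ0, hσ, ‖π‖ * (C * ‖ι‖), by positivity, fun n x => ?_⟩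
    have h1 : (K ^ n) (x - π (P (ι x))) = π ((K' ^ n) (ι x - P (ι x))) := by
      rw [hKπ, map_sub π, hπι]
    change ‖(K ^ n) (x - π (P (ι x)))‖ ≤ _
    rw [h1]
    calc _ ≤ ‖π‖ * (C * σ ^ n * (‖ι‖ * ‖x‖)) := by
          refine (π.le_opNorm _).trans ?_
          gcongr
          refine (h n _).trans ?_
          gcongr
          exact ι.le_opNorm x
      _ = _ := by ring
  · intro b hb hbρ
    obtain ⟨C, hC, h⟩ := hP'.expand b hb hbρ
    refine ⟨‖π‖ * (C * ‖ι‖), by positivity, fun n x => ?_⟩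
    change b ^ n * ‖π (P (ι x))‖ ≤ _ * ‖(K ^ n) (π (P (ι x)))‖
    calc b ^ n * ‖π (P (ι x))‖ ≤ b ^ n * (‖π‖ * ‖P (ι x)‖) := by
          gcongr
          exact π.le_opNorm _
      _ = ‖π‖ * (b ^ n * ‖P (ι x)‖) := by ring
      _ ≤ ‖π‖ * (C * (‖ι‖ * ‖(K ^ n) (π (P (ι x)))‖)) := by
          refine mul_le_mul_of_nonneg_left ((h n (ι x)).trans ?_) (norm_nonneg _)
          gcongr
          have h9 : (K' ^ n) (P (ι x)) = ι ((K ^ n) (π (P (ι x)))) := by rw [← hKι, ← hPι]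
          rw [h9]
          exact ι.le_opNorm _
      _ = _ := by ring

/-! ### Growth rates -/

section GrowthRates

variable {B : Type*} [NormedAddCommGroup B]

theorem logRate_le_coe_iff {t : ℝ≥0} (ht : 0 < t) (y : B) (b : ℝ) :
    logRate t y ≤ (b : EReal) ↔ ‖y‖ ≤ Real.exp (b * t) := by
  have ht' : (0 : EReal) < ((t : ℝ) : EReal) := by exact_mod_cast ht
  rw [logRate, EReal.div_le_iff_le_mul ht' (EReal.coe_ne_top _), ← EReal.coe_mul,
    ← EReal.log_exp ((t * b : ℝ) : EReal), ENNReal.log_le_log_iff, EReal.exp_coe, ← ofReal_norm,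
    ENNReal.ofReal_le_ofReal_iff (Real.exp_pos _).le, mul_comm]

theorem coe_le_logRate_iff {t : ℝ≥0} (ht : 0 < t) (y : B) (b : ℝ) :
    (b : EReal) ≤ logRate t y ↔ Real.exp (b * t) ≤ ‖y‖ := by
  have ht' : (0 : EReal) < ((t : ℝ) : EReal) := by exact_mod_cast ht
  rw [logRate, EReal.le_div_iff_mul_le ht' (EReal.coe_ne_top _), ← EReal.coe_mul,
    ← EReal.log_exp ((b * t : ℝ) : EReal), ENNReal.log_le_log_iff, EReal.exp_coe, ← ofReal_norm,
    ENNReal.ofReal_le_ofReal_iff (norm_nonneg _)]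

theorem eventually_const_mul_exp_le {σ b : ℝ} (h : σ < b) (C : ℝ) :
    ∀ᶠ t : ℝ≥0 in atTop, C * Real.exp (σ * t) ≤ Real.exp (b * t) := by
  have h1 : Tendsto (fun t : ℝ≥0 => (b - σ) * (t : ℝ)) atTop atTop :=
    (NNReal.tendsto_coe_atTop.2 tendsto_id).const_mul_atTop (sub_pos.2 h)
  filter_upwards [(Real.tendsto_exp_atTop.comp h1).eventually_ge_atTop C] with t ht
  have h2 : Real.exp (b * t) = Real.exp ((b - σ) * t) * Real.exp (σ * t) := by
    rw [← Real.exp_add]; congr 1; ring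
  rw [h2]
  gcongr
  exact ht

theorem limsup_logRate_le {y : ℝ≥0 → B} {σ C : ℝ}
    (h : ∀ t : ℝ≥0, ‖y t‖ ≤ C * Real.exp (σ * t)) :
    limsup (fun t => logRate t (y t)) atTop ≤ (σ : EReal) := by
  refine EReal.le_of_forall_lt_iff_le.1 fun b hb => ?_
  refine limsup_le_of_le (by isBoundedDefault) ?_
  filter_upwards [eventually_const_mul_exp_le (EReal.coe_lt_coe_iff.1 hb) C,
    eventually_gt_atTop 0] with t ht ht0
  exact (logRate_le_coe_iff ht0 _ _).2 ((h t).trans ht)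

theorem le_liminf_logRate {y : ℝ≥0 → B} {a c : ℝ} (hc : 0 < c)
    (h : ∀ t : ℝ≥0, c * Real.exp (a * t) ≤ ‖y t‖) :
    (a : EReal) ≤ liminf (fun t => logRate t (y t)) atTop := by
  refine EReal.ge_of_forall_gt_iff_ge.1 fun b hb => ?_
  refine le_liminf_of_le (by isBoundedDefault) ?_
  filter_upwards [eventually_const_mul_exp_le (EReal.coe_lt_coe_iff.1 hb) c⁻¹,
    eventually_gt_atTop 0] with t ht ht0
  refine (coe_le_logRate_iff ht0 _ _).2 (le_trans ?_ (h t))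
  rwa [← inv_mul_le_iff₀ hc]

theorem eventually_norm_le_of_limsup_lt {y : ℝ≥0 → B} {b : ℝ}
    (h : limsup (fun t => logRate t (y t)) atTop < (b : EReal)) :
    ∀ᶠ t : ℝ≥0 in atTop, ‖y t‖ ≤ Real.exp (b * t) := by
  filter_upwards [eventually_lt_of_limsup_lt h, eventually_gt_atTop 0] with t ht ht0
  exact (logRate_le_coe_iff ht0 _ _).1 ht.le

end GrowthRates

/-! ### Splittings of eventually compact semigroups -/

namespace C0Semigroup

variable {B : Type*} [NormedAddCommGroup B] [NormedSpace ℝ B]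

theorem op_add_apply (T : C0Semigroup B) (t s : ℝ≥0) (x : B) :
    T.op (t + s) x = T.op t (T.op s x) := by
  rw [T.op_add]
  rfl

theorem op_comm_apply (T : C0Semigroup B) (t s : ℝ≥0) (x : B) :
    T.op t (T.op s x) = T.op s (T.op t x) := by
  rw [← op_add_apply, ← op_add_apply, add_comm]

theorem op_natCast_mul (T : C0Semigroup B) (n : ℕ) (t : ℝ≥0) :
    T.op (n * t) = T.op t ^ n := by
  induction n with
  | zero =>
    rw [Nat.cast_zero, zero_mul, T.op_zero, pow_zero]
    rfl
  | succ n ih =>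
    rw [Nat.cast_succ, add_mul, one_mul, T.op_add, ih, pow_succ]
    rfl

theorem exists_norm_op_le [CompleteSpace B] (T : C0Semigroup B) (t₀ : ℝ≥0) :
    ∃ M, 0 ≤ M ∧ ∀ s ≤ t₀, ‖T.op s‖ ≤ M := by
  obtain ⟨M, hM⟩ := banach_steinhaus (g := fun s : Set.Icc (0 : ℝ≥0) t₀ => T.op s) (by
    intro x
    obtain ⟨C, hC⟩ := (isCompact_Icc (a := (0 : ℝ≥0)) (b := t₀)).exists_bound_of_continuousOn
      (T.continuous_op x).continuousOn
    exact ⟨C, fun s => hC s s.2⟩)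
  exact ⟨M, (norm_nonneg _).trans (hM ⟨0, by simp⟩), fun s hs => hM ⟨s, by simpa using hs⟩⟩

theorem exists_eq_add_natCast_mul {t₀ : ℝ≥0} (ht₀ : 0 < t₀) (t : ℝ≥0) :
    ∃ n : ℕ, ∃ s ≤ t₀, t = s + n * t₀ := by
  have h1 : (⌊t / t₀⌋₊ : ℝ≥0) * t₀ ≤ t := by
    rw [← le_div_iff₀ ht₀]
    exact Nat.floor_le zero_le
  have h2 : t ≤ (⌊t / t₀⌋₊ + 1 : ℝ≥0) * t₀ := by
    rw [← div_le_iff₀ ht₀]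
    exact (Nat.lt_floor_add_one _).le
  refine ⟨⌊t / t₀⌋₊, t - ⌊t / t₀⌋₊ * t₀, ?_, (tsub_add_cancel_of_le h1).symm⟩
  rw [tsub_le_iff_left]
  rwa [add_mul, one_mul] at h2

theorem exists_add_eq_natCast_mul {t₀ : ℝ≥0} (ht₀ : 0 < t₀) (t : ℝ≥0) :
    ∃ n : ℕ, ∃ s ≤ t₀, s + t = n * t₀ := by
  obtain ⟨n, s, hs, rfl⟩ := exists_eq_add_natCast_mul ht₀ t
  refine ⟨n + 1, t₀ - s, tsub_le_self, ?_⟩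
  rw [← add_assoc, tsub_add_cancel_of_le hs]
  push_cast
  ring

/-- Exponential bounds along the multiples of `t₀` pass to all times. -/
theorem exists_norm_op_le_of_pow_le [CompleteSpace B] (T : C0Semigroup B) {t₀ : ℝ≥0}
    (ht₀ : 0 < t₀) {σ : ℝ} (hσ : 0 < σ) :
    ∃ C, 0 ≤ C ∧ ∀ (y : B) (D : ℝ), (∀ n : ℕ, ‖(T.op t₀ ^ n) y‖ ≤ D * σ ^ n) →
      ∀ t : ℝ≥0, ‖T.op t y‖ ≤ C * D * Real.exp (Real.log σ / t₀ * t) := by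
  obtain ⟨M, hM0, hM⟩ := T.exists_norm_op_le t₀
  have ht₀' : (0 : ℝ) < t₀ := by exact_mod_cast ht₀
  set u := Real.log σ / t₀ with hu
  refine ⟨M * Real.exp (|u| * t₀), by positivity, fun y D hD t => ?_⟩
  have hD0 : 0 ≤ D := by simpa using (norm_nonneg _).trans (hD 0)
  obtain ⟨n, s, hs, rfl⟩ := exists_eq_add_natCast_mul ht₀ t
  have hexp : σ ^ n ≤ Real.exp (|u| * t₀) * Real.exp (u * ((s + n * t₀ : ℝ≥0) : ℝ)) := by
    have h1 : σ ^ n = Real.exp (u * (n * t₀)) := by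
      rw [hu, div_mul_eq_mul_div, mul_div_assoc, mul_div_cancel_right₀ _ ht₀'.ne', mul_comm,
        Real.exp_nat_mul, Real.exp_log hσ]
    rw [h1, ← Real.exp_add, Real.exp_le_exp]
    push_cast
    have hs' : (s : ℝ) ≤ t₀ := by exact_mod_cast hs
    have h2 : -(u * s) ≤ |u| * t₀ :=
      (neg_le_abs _).trans (by rw [abs_mul, NNReal.abs_eq]; gcongr)
    linarith
  rw [op_add_apply, op_natCast_mul]
  calc ‖T.op s ((T.op t₀ ^ n) y)‖ ≤ M * (D * σ ^ n) :=
        ((T.op s).le_opNorm _).trans (mul_le_mul (hM s hs) (hD n) (norm_nonneg _) hM0)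
    _ ≤ M * (D * (Real.exp (|u| * t₀) * Real.exp (u * ((s + n * t₀ : ℝ≥0) : ℝ)))) := by gcongr
    _ = _ := by ring

/-- The continuous-time analogue of `IsDominatedSplitting`, at the exponential rate `a`. -/
structure IsSplitting (T : C0Semigroup B) (P : B →L[ℝ] B) (a : ℝ) : Prop where
  idem : ∀ x, P (P x) = P x
  comm : ∀ t x, P (T.op t x) = T.op t (P x)
  finiteDimensional : FiniteDimensional ℝ P.toLinearMap.range
  contract : ∃ σ < a, ∃ C, 0 ≤ C ∧
    ∀ (t : ℝ≥0) x, ‖T.op t (x - P x)‖ ≤ C * Real.exp (σ * t) * ‖x‖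
  expand : ∀ b < a, ∃ C, 0 ≤ C ∧
    ∀ (t : ℝ≥0) x, Real.exp (b * t) * ‖P x‖ ≤ C * ‖T.op t (P x)‖

/-- The splitting of `T_{t₀}` at the rate `exp (a t₀)` splits the whole semigroup. -/
theorem exists_isSplitting [CompleteSpace B] (T : C0Semigroup B) {t₀ : ℝ≥0} (ht₀ : 0 < t₀)
    (hT : IsCompactOperator (T.op t₀)) (a : ℝ) : ∃ P, T.IsSplitting P a := by
  have ht₀' : (0 : ℝ) < t₀ := by exact_mod_cast ht₀
  obtain ⟨P, hP⟩ := exists_isDominatedSplitting hT (Real.exp_pos (a * t₀))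
  refine ⟨P, hP.apply_apply, fun t x => ?_, hP.finiteDimensional, ?_, ?_⟩
  · refine hP.apply_comm (Real.exp_pos _) (R := T.op t) ?_ x
    ext1 y
    exact T.op_comm_apply t t₀ y
  · obtain ⟨σ, hσ0, hσ, C, hC, h⟩ := hP.contract
    obtain ⟨C', hC', h'⟩ := T.exists_norm_op_le_of_pow_le ht₀ hσ0
    refine ⟨Real.log σ / t₀, ?_, C' * C, by positivity, fun t x => ?_⟩
    · rw [div_lt_iff₀ ht₀']
      exact (Real.log_lt_iff_lt_exp hσ0).2 hσ
    · refine (h' (x - P x) (C * ‖x‖) (fun n => (h n x).trans_eq (by ring)) t).trans_eq ?_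
      ring
  · intro b hb
    obtain ⟨C, hC, h⟩ := hP.expand (Real.exp (b * t₀)) (Real.exp_pos _) (by
      rw [Real.exp_lt_exp]; gcongr)
    obtain ⟨M, hM0, hM⟩ := T.exists_norm_op_le t₀
    refine ⟨Real.exp (|b| * t₀) * (C * M), by positivity, fun t x => ?_⟩
    obtain ⟨n, s, hs, hst⟩ := exists_add_eq_natCast_mul ht₀ t
    have hst' : (s : ℝ) + t = n * t₀ := by exact_mod_cast hst
    have hs' : (s : ℝ) ≤ t₀ := by exact_mod_cast hs
    have hexp : Real.exp (b * t) ≤ Real.exp (|b| * t₀) * Real.exp (b * t₀) ^ n := by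
      rw [← Real.exp_nat_mul, ← Real.exp_add, Real.exp_le_exp]
      have h2 : -(b * s) ≤ |b| * t₀ :=
        (neg_le_abs _).trans (by rw [abs_mul, NNReal.abs_eq]; gcongr)
      have h3 : (n : ℝ) * (b * t₀) = b * s + b * t := by rw [← mul_add, hst']; ring
      linarith
    have hK : ‖(T.op t₀ ^ n) (P x)‖ ≤ M * ‖T.op t (P x)‖ := by
      rw [← op_natCast_mul, ← hst, op_add_apply]
      exact ((T.op s).le_opNorm _).trans (by gcongr; exact hM s hs)
    calc Real.exp (b * t) * ‖P x‖
        ≤ Real.exp (|b| * t₀) * (Real.exp (b * t₀) ^ n * ‖P x‖) := by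
          rw [← mul_assoc]; gcongr
      _ ≤ Real.exp (|b| * t₀) * (C * (M * ‖T.op t (P x)‖)) := by
          refine mul_le_mul_of_nonneg_left ((h n x).trans ?_) (Real.exp_pos _).le
          gcongr
      _ = _ := by ring

end C0Semigroup

/-! ### Exponents of a semigroup and the slow subspaces -/

namespace C0Semigroup

variable {B : Type*} [NormedAddCommGroup B] [NormedSpace ℝ B]

/-- The upper exponential growth rate of the orbit of `x`. -/
noncomputable def rate (T : C0Semigroup B) (x : B) : EReal :=
  limsup (fun t : ℝ≥0 => logRate t (T.op t x)) atTop

theorem slow_mono (T : C0Semigroup B) {μ ν : EReal} (h : μ ≤ ν) : T.slow μ ≤ T.slow ν :=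
  fun _ hx => le_trans hx h

theorem op_mem_slow {T : C0Semigroup B} {μ : EReal} {x : B} (hx : x ∈ T.slow μ) (t : ℝ≥0) :
    T.op t x ∈ T.slow μ := by
  refine (limsup_logRate_le_max (fun s => T.op s x) (fun s => T.op s x)
    (fun s => T.op s (T.op t x)) ‖T.op t‖₊ fun s => ?_).trans (max_le hx hx)
  rw [max_self, op_comm_apply]
  exact (T.op t).le_opENorm _

namespace IsSplitting

variable {T : C0Semigroup B} {P : B →L[ℝ] B} {a : ℝ}

theorem le_liminf (h : T.IsSplitting P a) {x : B} (hx : P x ≠ 0) :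
    (a : EReal) ≤ liminf (fun t : ℝ≥0 => logRate t (T.op t x)) atTop := by
  refine EReal.ge_of_forall_gt_iff_ge.1 fun b hb => ?_
  obtain ⟨C, hC, hexp⟩ := h.expand b (EReal.coe_lt_coe_iff.1 hb)
  have hPx : 0 < ‖P x‖ := norm_pos_iff.2 hx
  refine le_liminf_logRate (c := ‖P x‖ / (C * ‖P‖ + 1)) (by positivity) fun t => ?_
  rw [div_mul_eq_mul_div, div_le_iff₀ (by positivity)]
  have h1 := hexp t x
  rw [← h.comm] at h1
  have h2 : C * ‖P (T.op t x)‖ ≤ C * (‖P‖ * ‖T.op t x‖) := by gcongr; exact P.le_opNorm _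
  have h3 : 0 ≤ ‖T.op t x‖ := norm_nonneg _
  nlinarith

theorem exists_rate_le (h : T.IsSplitting P a) :
    ∃ σ < a, ∀ x, P x = 0 → T.rate x ≤ (σ : EReal) := by
  obtain ⟨σ, hσ, C, -, hcon⟩ := h.contract
  refine ⟨σ, hσ, fun x hx => limsup_logRate_le (C := C * ‖x‖) fun t => ?_⟩
  have h1 := hcon t x
  rw [hx, sub_zero] at h1
  exact h1.trans_eq (by ring)

theorem rate_lt_iff (h : T.IsSplitting P a) {x : B} : T.rate x < a ↔ P x = 0 := by
  constructor
  · intro hx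
    by_contra hP
    exact ((h.le_liminf hP).trans liminf_le_limsup).not_gt hx
  · intro hx
    obtain ⟨σ, hσ, hr⟩ := h.exists_rate_le
    exact (hr x hx).trans_lt (EReal.coe_lt_coe_iff.2 hσ)

theorem injOn_op (h : T.IsSplitting P a) {x y : B} (t : ℝ≥0) (hx : P x = x) (hy : P y = y)
    (hxy : T.op t x = T.op t y) : x = y := by
  obtain ⟨C, hC, hexp⟩ := h.expand (a - 1) (by linarith)
  have h1 := hexp t (x - y)
  rw [map_sub, hx, hy, map_sub, hxy, sub_self, norm_zero, mul_zero] at h1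
  by_contra hne
  have : 0 < Real.exp ((a - 1) * t) * ‖x - y‖ :=
    mul_pos (Real.exp_pos _) (norm_pos_iff.2 (sub_ne_zero.2 hne))
  linarith

end IsSplitting

theorem exists_norm_op_apply_le_exp {T : C0Semigroup B} {x : B} {b : ℝ} (h : T.rate x < b) :
    ∃ C, ∀ t : ℝ≥0, ‖T.op t x‖ ≤ C * Real.exp (b * t) := by
  obtain ⟨t₁, ht₁⟩ := eventually_atTop.1 (eventually_norm_le_of_limsup_lt h)
  have hcont : Continuous fun t : ℝ≥0 => Real.exp (-(b * t)) • T.op t x :=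
    (by fun_prop : Continuous fun t : ℝ≥0 => Real.exp (-(b * t))).smul (T.continuous_op x)
  obtain ⟨C, hC⟩ := (isCompact_Icc (a := (0 : ℝ≥0)) (b := t₁)).exists_bound_of_continuousOn
    hcont.continuousOn
  refine ⟨max C 1, fun t => ?_⟩
  rcases le_total t₁ t with ht | ht
  · refine (ht₁ t ht).trans ?_
    exact le_mul_of_one_le_left (Real.exp_pos _).le (le_max_right _ _)
  · have h1 := hC t ⟨zero_le, ht⟩
    rw [norm_smul, Real.norm_eq_abs, abs_of_pos (Real.exp_pos _), Real.exp_neg,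
      inv_mul_le_iff₀ (Real.exp_pos _), mul_comm] at h1
    exact h1.trans (by gcongr; exact le_max_left _ _)

/-- On a finite-dimensional space the pointwise exponential bounds are uniform
(Banach-Steinhaus). -/
theorem exists_norm_op_le_exp_of_finiteDimensional {T : C0Semigroup B} {H : Submodule ℝ B}
    [FiniteDimensional ℝ H] {b : ℝ} (h : ∀ x ∈ H, T.rate x < b) :
    ∃ C, 0 ≤ C ∧ ∀ (t : ℝ≥0), ∀ x ∈ H, ‖T.op t x‖ ≤ C * Real.exp (b * t) * ‖x‖ := by
  have : CompleteSpace H := FiniteDimensional.complete ℝ H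
  obtain ⟨C, hC⟩ := banach_steinhaus
    (g := fun t : ℝ≥0 => Real.exp (-(b * t)) • (T.op t).comp H.subtypeL) (by
      intro x
      obtain ⟨C, hC⟩ := exists_norm_op_apply_le_exp (h x x.2)
      refine ⟨C, fun t => ?_⟩
      change ‖Real.exp (-(b * t)) • T.op t x‖ ≤ C
      rw [norm_smul, Real.norm_eq_abs, abs_of_pos (Real.exp_pos _), Real.exp_neg,
        inv_mul_le_iff₀ (Real.exp_pos _), mul_comm]
      exact hC t)
  refine ⟨C, (norm_nonneg _).trans (hC 0), fun t x hx => ?_⟩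
  have h1 : ‖Real.exp (-(b * t)) • T.op t x‖ ≤ C * ‖x‖ :=
    (ContinuousLinearMap.le_opNorm (Real.exp (-(b * t)) • (T.op t).comp H.subtypeL)
      ⟨x, hx⟩).trans (mul_le_mul_of_nonneg_right (hC t) (norm_nonneg _))
  rw [norm_smul, Real.norm_eq_abs, abs_of_pos (Real.exp_pos _), Real.exp_neg,
    inv_mul_le_iff₀ (Real.exp_pos _)] at h1
  exact h1.trans_eq (by ring)

/-! ### Fast spaces -/

section FastSpace

variable {T : C0Semigroup B} {P : B →L[ℝ] B} {a : ℝ} {b : EReal}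

theorem IsSplitting.apply_eq_self_of_mem (h : T.IsSplitting P a) {H : Submodule ℝ B} {x : B}
    (hx : x ∈ P.toLinearMap.range ⊓ H) : P x = x := by
  obtain ⟨y, hy⟩ := hx.1
  rw [← hy]
  exact h.idem y

/-- If `slow b` is `ker P`, then `range P ⊓ slow a` is a fast space for `a > b`: `expand` bounds the
forward rate below and the backward rate above, membership in `slow a` gives the other two
bounds. -/
theorem IsSplitting.isFastSpace (h : T.IsSplitting P a) (hba : b ≤ a)
    (hb : ∀ x, x ∈ T.slow b ↔ P x = 0) :
    T.IsFastSpace a b (Module.finrank ℝ ↥(P.toLinearMap.range ⊓ T.slow a))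
      (P.toLinearMap.range ⊓ T.slow a) := by
  set H := P.toLinearMap.range ⊓ T.slow a with hH
  have hfinP := h.finiteDimensional
  have hfin : FiniteDimensional ℝ H := Submodule.finiteDimensional_of_le inf_le_left
  have hPH : ∀ x ∈ H, P x = x := fun x hx => h.apply_eq_self_of_mem hx
  have hmem : ∀ x, P x = x → x ∈ T.slow a → x ∈ H := fun x hx hx' => ⟨⟨x, hx⟩, hx'⟩
  have hinj : ∀ t : ℝ≥0, Set.InjOn (T.op t) (H : Set B) := fun t x hx y hy hxy =>
    h.injOn_op t (hPH x hx) (hPH y hy) hxy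
  have hmaps : ∀ t : ℝ≥0, ∀ x ∈ H, T.op t x ∈ H := fun t x hx =>
    hmem _ (by rw [h.comm, hPH x hx]) (op_mem_slow hx.2 t)
  have hsurj : ∀ t : ℝ≥0, ∀ x ∈ H, ∃ y ∈ H, T.op t y = x := by
    intro t x hx
    have h1 : Function.Injective ((T.op t).toLinearMap.restrict (hmaps t)) := fun y z hyz =>
      Subtype.ext (hinj t y.2 z.2 (congrArg Subtype.val hyz))
    obtain ⟨y, hy⟩ := LinearMap.surjective_of_injective h1 ⟨x, hx⟩
    exact ⟨y, y.2, congrArg Subtype.val hy⟩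
  refine ⟨hfin, rfl, fun t => ?_, ?_, ?_, fun x hx hx0 => ?_, hinj, fun x hx hx0 => ?_⟩
  · refine le_antisymm ?_ ?_
    · rintro _ ⟨x, hx, rfl⟩
      exact hmaps t x hx
    · intro x hx
      obtain ⟨y, hy, hyx⟩ := hsurj t x hx
      exact ⟨y, hy, hyx⟩
  · rw [Submodule.disjoint_def]
    intro x hx hxb
    rw [← hPH x hx]
    exact (hb x).1 hxb
  · refine le_antisymm (sup_le inf_le_right (T.slow_mono hba)) fun x hx => ?_
    have h1 : x - P x ∈ T.slow b := (hb _).2 (by rw [map_sub, h.idem, sub_self])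
    refine Submodule.mem_sup.2 ⟨P x, hmem _ (h.idem x) ?_, x - P x, h1, by abel⟩
    have : P x = x - (x - P x) := by abel
    rw [this]
    exact sub_mem hx (T.slow_mono hba h1)
  · exact tendsto_of_le_liminf_of_limsup_le (h.le_liminf (by rwa [hPH x hx])) hx.2
  · set y : ℝ≥0 → B := fun t => Function.invFunOn (T.op t) (H : Set B) x with hy
    have hyH : ∀ t, y t ∈ H := fun t => Function.invFunOn_mem (hsurj t x hx)
    have hyx : ∀ t, T.op t (y t) = x := fun t => Function.invFunOn_eq (hsurj t x hx)
    have hx0' : 0 < ‖x‖ := norm_pos_iff.2 hx0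
    change Tendsto (fun t => logRate t (y t)) atTop (𝓝 (-(a : EReal)))
    rw [← EReal.coe_neg]
    refine tendsto_of_le_liminf_of_limsup_le ?_ ?_
    · refine EReal.ge_of_forall_gt_iff_ge.1 fun c hc => ?_
      have hc' : a < -c := by
        have := EReal.coe_lt_coe_iff.1 hc
        linarith
      obtain ⟨C, hC, hup⟩ := exists_norm_op_le_exp_of_finiteDimensional (T := T) (H := H)
        (b := -c) fun x hx => lt_of_le_of_lt hx.2 (EReal.coe_lt_coe_iff.2 hc')
      refine le_liminf_logRate (c := ‖x‖ / (C + 1)) (by positivity) fun t => ?_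
      rw [div_mul_eq_mul_div, div_le_iff₀ (by positivity)]
      have h1 := hup t (y t) (hyH t)
      rw [hyx] at h1
      have h2 : Real.exp (-c * t) * Real.exp (c * t) = 1 := by
        rw [← Real.exp_add, neg_mul, neg_add_cancel, Real.exp_zero]
      calc ‖x‖ * Real.exp (c * t) ≤ C * Real.exp (-c * t) * ‖y t‖ * Real.exp (c * t) := by gcongr
        _ = C * ‖y t‖ * (Real.exp (-c * t) * Real.exp (c * t)) := by ring
        _ ≤ ‖y t‖ * (C + 1) := by rw [h2]; nlinarith [norm_nonneg (y t)]
    · refine EReal.le_of_forall_lt_iff_le.1 fun c hc => ?_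
      have hc' : -c < a := by
        have := EReal.coe_lt_coe_iff.1 hc
        linarith
      obtain ⟨C, hC, hexp⟩ := h.expand (-c) hc'
      refine limsup_logRate_le (C := C * ‖x‖) fun t => ?_
      have h1 := hexp t (y t)
      rw [hPH _ (hyH t), hyx, neg_mul, Real.exp_neg, inv_mul_le_iff₀ (Real.exp_pos _)] at h1
      exact h1.trans_eq (by ring)

/-- A fast space has backward orbits of exact rate `-a`; such an orbit has no component in `ker P`,
on which the semigroup grows strictly slower. -/
theorem IsSplitting.fastSpace_le (h : T.IsSplitting P a) {m : ℕ} {H : Submodule ℝ B}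
    (hH : T.IsFastSpace a b m H) : H ≤ P.toLinearMap.range ⊓ T.slow a := by
  intro x hx
  refine ⟨?_, hH.sup_eq ▸ Submodule.mem_sup_left hx⟩
  by_cases hx0 : x = 0
  · rw [hx0]
    exact zero_mem _
  have hsurj : ∀ t, ∃ y ∈ (H : Set B), T.op t y = x := fun t => by
    have := hx
    rw [← hH.invariant t] at this
    exact this
  have htend := hH.backward x hx hx0
  set y : ℝ≥0 → B := fun t => Function.invFunOn (T.op t) (H : Set B) x with hy
  have hyx : ∀ t, T.op t (y t) = x := fun t => Function.invFunOn_eq (hsurj t)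
  obtain ⟨σ, hσ, C, hC, hcon⟩ := h.contract
  obtain ⟨c, hσc, hca⟩ := exists_between hσ
  have hev : ∀ᶠ t : ℝ≥0 in atTop, ‖y t‖ ≤ Real.exp (-c * t) := by
    refine eventually_norm_le_of_limsup_lt ?_
    rw [htend.limsup_eq, ← EReal.coe_neg, EReal.coe_lt_coe_iff]
    linarith
  have hlim : Tendsto (fun t : ℝ≥0 => C * Real.exp ((σ - c) * t)) atTop (𝓝 0) := by
    have h1 : Tendsto (fun t : ℝ≥0 => (σ - c) * (t : ℝ)) atTop atBot :=
      (NNReal.tendsto_coe_atTop.2 tendsto_id).const_mul_atTop_of_neg (by linarith)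
    simpa using (Real.tendsto_exp_atBot.comp h1).const_mul C
  have hle : ∀ᶠ t : ℝ≥0 in atTop, ‖x - P x‖ ≤ C * Real.exp ((σ - c) * t) := by
    filter_upwards [hev] with t ht
    have h1 := hcon t (y t)
    rw [map_sub, ← h.comm, hyx] at h1
    calc ‖x - P x‖ ≤ C * Real.exp (σ * t) * ‖y t‖ := h1
      _ ≤ C * Real.exp (σ * t) * Real.exp (-c * t) := by gcongr
      _ = _ := by rw [mul_assoc, ← Real.exp_add]; congr 2; ring
  have h2 : x - P x = 0 := norm_le_zero_iff.1 (ge_of_tendsto hlim hle)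
  exact ⟨x, (sub_eq_zero.1 h2).symm⟩

theorem IsSplitting.fastSpace_eq (h : T.IsSplitting P a) {m : ℕ} {H : Submodule ℝ B}
    (hm : Module.finrank ℝ ↥(P.toLinearMap.range ⊓ T.slow a) = m)
    (hH : T.IsFastSpace a b m H) : H = P.toLinearMap.range ⊓ T.slow a := by
  have := h.finiteDimensional
  have : FiniteDimensional ℝ ↥(P.toLinearMap.range ⊓ T.slow a) :=
    Submodule.finiteDimensional_of_le inf_le_left
  exact Submodule.eq_of_le_of_finrank_eq (h.fastSpace_le hH) (hH.finrank_eq.trans hm.symm)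

end FastSpace

end C0Semigroup

/-! ### Complements along a filtration -/

theorem finrank_quotient_add_of_disjoint {V : Type*} [AddCommGroup V] [Module ℝ V]
    {H G G' : Submodule ℝ V} [FiniteDimensional ℝ (V ⧸ G')] (hd : Disjoint H G')
    (hs : H ⊔ G' = G) :
    Module.finrank ℝ (V ⧸ G) + Module.finrank ℝ H = Module.finrank ℝ (V ⧸ G') := by
  have hle : G' ≤ G := hs ▸ le_sup_right
  let f : (V ⧸ G') →ₗ[ℝ] V ⧸ G := G'.liftQ G.mkQ (by rwa [Submodule.ker_mkQ])
  have hf : f.range = ⊤ := by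
    rw [Submodule.range_liftQ, Submodule.range_mkQ]
  have hker : f.ker = H.map G'.mkQ := by
    rw [Submodule.ker_liftQ, Submodule.ker_mkQ, ← hs, Submodule.map_sup]
    simp
  have hinj : Function.Injective (G'.mkQ ∘ₗ H.subtype) := by
    rw [← LinearMap.ker_eq_bot, LinearMap.ker_comp, Submodule.ker_mkQ]
    exact Submodule.disjoint_iff_comap_eq_bot.1 hd
  have h1 := LinearMap.finrank_range_of_inj hinj
  rw [LinearMap.range_comp, Submodule.range_subtype, ← hker] at h1
  have h2 := f.finrank_range_add_finrank_ker
  rw [hf, finrank_top, h1] at h2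
  exact h2

theorem eq_zero_of_sum_add_eq_zero_of_filtration {V : Type*} [AddCommGroup V] [Module ℝ V]
    (F H : ℕ → Submodule ℝ V) (n : ℕ) (hd : ∀ k < n, Disjoint (H k) (F (k + 1)))
    (hs : ∀ k < n, H k ⊔ F (k + 1) = F k) (v : Fin n → V) (f : V)
    (hv : ∀ k : Fin n, v k ∈ H k) (hf : f ∈ F n) (hsum : (∑ k, v k) + f = 0) :
    f = 0 ∧ ∀ k, v k = 0 := by
  induction n generalizing f with
  | zero => exact ⟨by simpa using hsum, fun k => k.elim0⟩
  | succ n ih =>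
    have hlast : v (Fin.last n) ∈ H n := hv (Fin.last n)
    have hmem : v (Fin.last n) + f ∈ F n := by
      rw [← hs n (Nat.lt_succ_self n)]
      exact add_mem (Submodule.mem_sup_left hlast) (Submodule.mem_sup_right hf)
    rw [Fin.sum_univ_castSucc, add_assoc] at hsum
    obtain ⟨h1, h2⟩ := ih (fun k hk => hd k (by omega)) (fun k hk => hs k (by omega))
      (fun k => v k.castSucc) _ (fun k => hv k.castSucc) hmem hsum
    have h3 : v (Fin.last n) = 0 := by
      refine Submodule.disjoint_def.1 (hd n (Nat.lt_succ_self n)) _ hlast ?_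
      rw [eq_neg_of_add_eq_zero_left h1]
      exact neg_mem hf
    refine ⟨by simpa [h3] using h1, fun k => ?_⟩
    induction k using Fin.lastCases with
    | last => exact h3
    | cast k => exact h2 k

/-- If each `H k` complements `F (k + 1)` in `F k`, then `H 0, …, H (n - 1), F n` is a direct sum
decomposition of `F 0 = ⊤`. -/
theorem isInternal_option_of_filtration {V : Type*} [AddCommGroup V] [Module ℝ V]
    (F H : ℕ → Submodule ℝ V) (h0 : F 0 = ⊤) (n : ℕ) (hd : ∀ k < n, Disjoint (H k) (F (k + 1)))
    (hs : ∀ k < n, H k ⊔ F (k + 1) = F k) :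
    DirectSum.IsInternal fun o : Option (Fin n) => o.elim (F n) fun k => H k := by
  classical
  set A : Option (Fin n) → Submodule ℝ V := fun o => o.elim (F n) fun k => H k with hA
  refine DirectSum.isInternal_submodule_of_iSupIndep_of_iSup_eq_top ?_ ?_
  · rw [iSupIndep_iff_finsetSum_eq_zero_imp_eq_zero]
    intro s v hv hsum
    have hw : ∀ o, (if o ∈ s then v o else 0) ∈ A o := by
      intro o
      split_ifs with ho
      · exact hv o ho
      · exact zero_mem _
    have hsum' : ∑ o, (if o ∈ s then v o else 0) = 0 := by
      rw [Finset.sum_ite_mem, Finset.univ_inter, hsum]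
    rw [Fintype.sum_option, add_comm] at hsum'
    obtain ⟨h1, h2⟩ := eq_zero_of_sum_add_eq_zero_of_filtration F H n hd hs _ _
      (fun k => hw (some k)) (hw none) hsum'
    intro o ho
    cases o with
    | none => simpa [ho] using h1
    | some k => simpa [ho] using h2 k
  · have hF : ∀ j ≤ n, F (n - j) ≤ ⨆ o, A o := by
      intro j
      induction j with
      | zero => exact fun _ => le_iSup A none
      | succ j ih =>
        intro hj
        have h1 := hs (n - (j + 1)) (by omega)
        rw [show n - (j + 1) + 1 = n - j by omega] at h1
        rw [← h1]
        exact sup_le (le_iSup A (some ⟨n - (j + 1), by omega⟩)) (ih (by omega))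
    have h1 := hF n le_rfl
    rw [Nat.sub_self, h0] at h1
    exact top_le_iff.1 h1

/-! ### The Lyapunov exponents -/

namespace C0Semigroup

variable {B : Type*} [NormedAddCommGroup B] [NormedSpace ℝ B]

/-- The Lyapunov exponents in decreasing order, continued by `⊥` once they are exhausted: each is
the supremum of the growth rates strictly below the one before it. -/
noncomputable def exponent (T : C0Semigroup B) : ℕ → EReal
  | 0 => ⨆ x, T.rate x
  | n + 1 => ⨆ x, ⨆ _ : T.rate x < T.exponent n, T.rate x

theorem slow_exponent_zero (T : C0Semigroup B) : T.slow (T.exponent 0) = ⊤ :=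
  eq_top_iff.2 fun x _ => le_iSup T.rate x

theorem exponent_succ_of_eq_bot {T : C0Semigroup B} {n : ℕ} (h : T.exponent n = ⊥) :
    T.exponent (n + 1) = ⊥ := by
  simp [exponent, h]

theorem exponent_succ_le (T : C0Semigroup B) (n : ℕ) : T.exponent (n + 1) ≤ T.exponent n :=
  iSup₂_le fun _ h => h.le

theorem antitone_exponent (T : C0Semigroup B) : Antitone T.exponent :=
  antitone_nat_of_succ_le T.exponent_succ_le

/-- Each exponent is the least `μ` with its slow space. -/
theorem exponent_le_of_slow_le {T : C0Semigroup B} {n : ℕ} {μ : EReal}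
    (h : T.slow (T.exponent n) ≤ T.slow μ) : T.exponent n ≤ μ := by
  cases n with
  | zero => exact iSup_le fun x => h (by rw [slow_exponent_zero]; trivial)
  | succ n => exact iSup₂_le fun x hx => h (le_iSup₂ (f := fun x _ => T.rate x) x hx)

theorem exists_rate_le_coe [CompleteSpace B] (T : C0Semigroup B) :
    ∃ ω : ℝ, ∀ x, T.rate x ≤ (ω : EReal) := by
  obtain ⟨C, hC, h⟩ := T.exists_norm_op_le_of_pow_le (t₀ := 1) one_pos
    (σ := ‖T.op 1‖ + 1) (by positivity)
  refine ⟨_, fun x => limsup_logRate_le (h x ‖x‖ fun n => ?_)⟩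
  induction n generalizing x with
  | zero => simp
  | succ n ih =>
    rw [pow_succ, pow_succ]
    change ‖(T.op 1 ^ n) (T.op 1 x)‖ ≤ _
    calc _ ≤ ‖T.op 1 x‖ * (‖T.op 1‖ + 1) ^ n := ih _
      _ ≤ ((‖T.op 1‖ + 1) * ‖x‖) * (‖T.op 1‖ + 1) ^ n := by
        gcongr
        exact ((T.op 1).le_opNorm x).trans (by gcongr; linarith)
      _ = _ := by ring

theorem exponent_lt_top [CompleteSpace B] (T : C0Semigroup B) (n : ℕ) : T.exponent n < ⊤ := by
  obtain ⟨ω, hω⟩ := T.exists_rate_le_coe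
  exact ((T.antitone_exponent n.zero_le).trans (iSup_le hω)).trans_lt (EReal.coe_lt_top ω)

theorem exists_exponent_eq_coe [CompleteSpace B] {T : C0Semigroup B} {n : ℕ}
    (h : T.exponent n ≠ ⊥) : ∃ a : ℝ, T.exponent n = a :=
  ⟨_, (EReal.coe_toReal (T.exponent_lt_top n).ne h).symm⟩

theorem IsSplitting.exponent_succ_lt {T : C0Semigroup B} {P : B →L[ℝ] B} {a : ℝ} {n : ℕ}
    (h : T.IsSplitting P a) (ha : T.exponent n = a) : T.exponent (n + 1) < T.exponent n := by
  obtain ⟨σ, hσ, hr⟩ := h.exists_rate_le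
  rw [ha]
  refine lt_of_le_of_lt (iSup₂_le fun x hx => hr x ?_) (EReal.coe_lt_coe_iff.2 hσ)
  rw [ha] at hx
  exact h.rate_lt_iff.1 hx

theorem IsSplitting.mem_slow_exponent_succ_iff {T : C0Semigroup B} {P : B →L[ℝ] B} {a : ℝ} {n : ℕ}
    (h : T.IsSplitting P a) (ha : T.exponent n = a) {x : B} :
    x ∈ T.slow (T.exponent (n + 1)) ↔ P x = 0 := by
  constructor
  · intro hx
    refine h.rate_lt_iff.1 (lt_of_le_of_lt hx ?_)
    rw [← ha]
    exact h.exponent_succ_lt ha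
  · intro hx
    refine le_iSup₂ (f := fun x (_ : T.rate x < T.exponent n) => T.rate x) x ?_
    rw [ha]
    exact h.rate_lt_iff.2 hx

theorem IsSplitting.finiteDimensional_quotient {T : C0Semigroup B} {P : B →L[ℝ] B} {a : ℝ}
    (h : T.IsSplitting P a) {G : Submodule ℝ B} (hG : ∀ x, P x = 0 → x ∈ G) :
    FiniteDimensional ℝ (B ⧸ G) ∧
      Module.finrank ℝ (B ⧸ G) ≤ Module.finrank ℝ P.toLinearMap.range := by
  have := h.finiteDimensional
  let f : P.toLinearMap.range →ₗ[ℝ] B ⧸ G := G.mkQ ∘ₗ P.toLinearMap.range.subtype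
  have hf : Function.Surjective f := by
    intro q
    obtain ⟨x, rfl⟩ := G.mkQ_surjective q
    refine ⟨⟨P x, ⟨x, rfl⟩⟩, ?_⟩
    change G.mkQ (P x) = G.mkQ x
    refine (Submodule.Quotient.eq G).2 (hG _ ?_)
    rw [map_sub, h.idem, sub_self]
  exact ⟨Module.Finite.of_surjective f hf, LinearMap.finrank_le_finrank_of_surjective hf⟩

theorem finiteDimensional_quotient_slow_exponent [CompleteSpace B] {T : C0Semigroup B}
    (hsp : ∀ a : ℝ, ∃ P, T.IsSplitting P a) (n : ℕ) :
    FiniteDimensional ℝ (B ⧸ T.slow (T.exponent n)) := by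
  induction n with
  | zero =>
    rw [slow_exponent_zero]
    infer_instance
  | succ n ih =>
    by_cases hn : T.exponent n = ⊥
    · rwa [exponent_succ_of_eq_bot hn, ← hn]
    · obtain ⟨a, ha⟩ := exists_exponent_eq_coe hn
      obtain ⟨P, hP⟩ := hsp a
      exact (hP.finiteDimensional_quotient fun x =>
        (hP.mem_slow_exponent_succ_iff ha).2).1

end C0Semigroup

open C0Semigroup in
theorem proposition5p4 {B : Type*} [NormedAddCommGroup B] [NormedSpace ℝ B] [CompleteSpace B]
    (T : C0Semigroup B) (r : ℝ)
    (hT : ∀ t : ℝ≥0, r < (t : ℝ) → IsCompactOperator (T.op t)) :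
    ∃ (lam : ℕ → EReal) (m : ℕ → ℕ) (H : ℕ → Submodule ℝ B),
      (∀ i, lam i < ⊤) ∧
      (∀ i, lam (i + 1) < lam i ∨ (lam i = ⊥ ∧ lam (i + 1) = ⊥)) ∧
      Tendsto lam atTop (𝓝 ⊥) ∧
      -- the filtration
      T.slow (lam 0) = ⊤ ∧
      (∀ i, T.slow (lam (i + 1)) ≤ T.slow (lam i)) ∧
      (∀ i, lam (i + 1) < lam i → ∀ x : B,
        (x ∈ T.slow (lam i) ∧ x ∉ T.slow (lam (i + 1))) ↔
          Tendsto (fun t : ℝ≥0 => logRate t (T.op t x)) atTop (𝓝 (lam i))) ∧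
      -- finite codimension and multiplicities
      (∀ j, FiniteDimensional ℝ (B ⧸ T.slow (lam j)) ∧
        Module.finrank ℝ (B ⧸ T.slow (lam j)) = ∑ k ∈ Finset.range j, m k) ∧
      (∀ i, lam (i + 1) < lam i → 0 < m i) ∧
      -- the unique fast-growing spaces
      (∀ i, lam (i + 1) < lam i →
        T.IsFastSpace (lam i) (lam (i + 1)) (m i) (H i) ∧
        ∀ H' : Submodule ℝ B, T.IsFastSpace (lam i) (lam (i + 1)) (m i) H' → H' = H i) ∧
      -- `B = H^1 ⊕ ⋯ ⊕ H^{i+1} ⊕ F_{λ_{i+2}}`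
      (∀ i, lam (i + 1) < lam i →
        DirectSum.IsInternal fun o : Option (Fin (i + 1)) =>
          o.elim (T.slow (lam (i + 1))) fun k => H k) := by
  have hsp : ∀ a : ℝ, ∃ P, T.IsSplitting P a :=
    T.exists_isSplitting (t₀ := r.toNNReal + 1) (by positivity)
      (hT _ (lt_of_le_of_lt (Real.le_coe_toNNReal r) (by simp)))
  choose P hP using hsp
  have hsp : ∀ a : ℝ, ∃ P, T.IsSplitting P a := fun a => ⟨P a, hP a⟩
  have hfin := finiteDimensional_quotient_slow_exponent hsp
  have hreal : ∀ {i}, T.exponent (i + 1) < T.exponent i → ∃ a : ℝ, T.exponent i = a :=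
    fun h => exists_exponent_eq_coe (ne_bot_of_gt h)
  have hlt : ∀ {i}, T.exponent i ≠ ⊥ → T.exponent (i + 1) < T.exponent i := fun h => by
    obtain ⟨a, ha⟩ := exists_exponent_eq_coe h
    exact (hP a).exponent_succ_lt ha
  -- the fast space at a `⊥` exponent is taken to be `0`, so that its dimension is `m i = 0`
  let H : ℕ → Submodule ℝ B := fun i => if T.exponent i = ⊥ then ⊥ else
    (P (T.exponent i).toReal).toLinearMap.range ⊓ T.slow (T.exponent i)
  have hfast : ∀ i, T.exponent (i + 1) < T.exponent i →
      T.IsFastSpace (T.exponent i) (T.exponent (i + 1)) (Module.finrank ℝ (H i)) (H i) ∧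
      ∀ H' : Submodule ℝ B, T.IsFastSpace (T.exponent i) (T.exponent (i + 1))
        (Module.finrank ℝ (H i)) H' → H' = H i := by
    intro i hi
    obtain ⟨a, ha⟩ := hreal hi
    have hHi : H i = (P a).toLinearMap.range ⊓ T.slow a := by
      simp only [H, if_neg (ne_bot_of_gt hi), ha, EReal.toReal_coe]
    have h1 := (hP a).isFastSpace (b := T.exponent (i + 1)) (ha ▸ hi.le)
      fun x => (hP a).mem_slow_exponent_succ_iff ha
    rw [hHi, ha]
    exact ⟨h1, fun H' hH' => (hP a).fastSpace_eq rfl hH'⟩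
  have hcodim : ∀ j, Module.finrank ℝ (B ⧸ T.slow (T.exponent j)) =
      ∑ k ∈ Finset.range j, Module.finrank ℝ (H k) := by
    intro j
    induction j with
    | zero =>
      rw [slow_exponent_zero, Finset.sum_range_zero]
      exact Module.finrank_zero_of_subsingleton
    | succ j ih =>
      rw [Finset.sum_range_succ, ← ih]
      by_cases hj : T.exponent j = ⊥
      · have h1 : T.exponent (j + 1) = T.exponent j := by rw [exponent_succ_of_eq_bot hj, hj]
        have h2 : H j = ⊥ := if_pos hj
        rw [h1, h2, finrank_bot, add_zero]
      · have h1 := (hfast j (hlt hj)).1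
        have := hfin (j + 1)
        exact (finrank_quotient_add_of_disjoint h1.disjoint h1.sup_eq).symm
  have hpos : ∀ i, T.exponent (i + 1) < T.exponent i → 0 < Module.finrank ℝ (H i) := by
    intro i hi
    have h1 := (hfast i hi).1
    have := h1.finiteDimensional
    by_contra! h0
    have h2 : H i = ⊥ := Submodule.finrank_eq_zero.1 (Nat.le_zero.1 h0)
    have h3 := h1.sup_eq
    rw [h2, bot_sup_eq] at h3
    exact (exponent_le_of_slow_le h3.ge).not_gt hi
  refine ⟨T.exponent, fun i => Module.finrank ℝ (H i), H, T.exponent_lt_top, fun i => ?_, ?_,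
    T.slow_exponent_zero, fun i => T.slow_mono (T.exponent_succ_le i), fun i hi x => ?_,
    fun j => ⟨hfin j, hcodim j⟩, hpos, hfast, fun i hi => ?_⟩
  · by_cases h : T.exponent i = ⊥
    · exact Or.inr ⟨h, exponent_succ_of_eq_bot h⟩
    · exact Or.inl (hlt h)
  · -- a finite limit `L` would bound all codimensions by the rank of the splitting at `L`
    have hlim := tendsto_atTop_iInf T.antitone_exponent
    convert hlim using 2
    by_contra hne
    have hL : (⨅ i, T.exponent i) ≠ ⊥ := fun h => hne h.symm
    obtain ⟨L, hL'⟩ : ∃ L : ℝ, (⨅ i, T.exponent i) = L :=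
      ⟨_, (EReal.coe_toReal ((iInf_le _ 0).trans_lt (T.exponent_lt_top 0)).ne hL).symm⟩
    have hge : ∀ i, (L : EReal) ≤ T.exponent i := fun i => hL' ▸ iInf_le _ i
    have hbd : ∀ j, j ≤ Module.finrank ℝ (P L).toLinearMap.range := by
      intro j
      have h1 := ((hP L).finiteDimensional_quotient (G := T.slow (T.exponent j)) fun x hx =>
        ((hP L).rate_lt_iff.2 hx).le.trans (hge j)).2
      rw [hcodim j] at h1
      refine le_trans ?_ h1
      calc j = ∑ k ∈ Finset.range j, 1 := by simp
        _ ≤ _ := Finset.sum_le_sum fun k _ =>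
          hpos k (hlt (ne_bot_of_le_ne_bot (EReal.coe_ne_bot L) (hge k)))
    exact absurd (hbd _) (Nat.not_succ_le_self _)
  · obtain ⟨a, ha⟩ := hreal hi
    rw [(hP a).mem_slow_exponent_succ_iff ha, ha]
    constructor
    · rintro ⟨hx, hPx⟩
      exact tendsto_of_le_liminf_of_limsup_le ((hP a).le_liminf hPx) hx
    · intro hx
      have h1 : T.rate x = a := hx.limsup_eq
      exact ⟨h1.le, fun hPx => ((hP a).rate_lt_iff.2 hPx).ne h1⟩
  · have hne : ∀ k < i + 1, T.exponent (k + 1) < T.exponent k := fun k hk =>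
      hlt (ne_bot_of_le_ne_bot (ne_bot_of_gt hi) (T.antitone_exponent (Nat.lt_succ_iff.1 hk)))
    exact isInternal_option_of_filtration (fun j => T.slow (T.exponent j)) H T.slow_exponent_zero
      (i + 1) (fun k hk => (hfast k (hne k hk)).1.disjoint)
      fun k hk => (hfast k (hne k hk)).1.sup_eq
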